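/- Let $\mathbb D'=\{z\in\mathbb C: z\neq 0,\ |z|\le 1,\ z\ne 1\}$ and let $u,v,w\in\mathbb D'$ be pairwise distinct. Then the integral $$\mathcal F(1;u,v,w)=\int_0^1\frac{\log(1-ut)\,\log(1-wt)}{v^{-1}-t}\,dt$$ (principal logarithms) converges, and \begin{align*} \mathcal F(1;u,v,w) ={}& \log(1-u)\log\Big(\tfrac{u(1-v)}{u-v}\Big)\log\Big(\tfrac{v}{v-w}\Big) - \log(1-w)\,\mathrm{Li}_2\Big(\tfrac{v(1-u)}{v-u}\Big)\\ & - \log(1-u)\log\Big(\tfrac{w(1-v)}{w-v}\Big)\log\Big(\tfrac{v(1-w)}{v-w}\Big) - \log(1-u)\,\mathrm{Li}_2\Big(\tfrac{v(1-w)}{v-w}\Big)\\ & - \log\Big(\tfrac{v-u}{v-w}\Big)\Big[\mathrm{Li}_2\Big(\tfrac{v(w-u)}{w(v-u)}\Big) - \log\Big(\tfrac{w}{w-u}\Big)\log\Big(\tfrac{u(w-v)}{w(u-v)}\Big)\Big]\\ & + \log\Big(\tfrac{(v-u)(w-1)}{(v-w)(u-1)}\Big)\Big[\mathrm{Li}_2\Big(\tfrac{(v-u)(w-1)}{(v-w)(u-1)}\Big)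 + \mathrm{Li}_2\Big(\tfrac{v(1-u)}{v-u}\Big) - \mathrm{Li}_2\Big(\tfrac{v(1-w)}{v-w}\Big) - \mathrm{Li}_2\Big(\tfrac{u(1-w)}{w(1-u)}\Big)\Big]\\ & + \tfrac12\log\Big(\tfrac{w(u-v)}{u(w-v)}\Big)\Big[\log^2\Big(\tfrac{u-v}{v(u-1)}\Big) - \log^2\Big(\tfrac{v}{v-u}\Big)\Big]\\ & + \mathrm{Li}_3\Big(\tfrac{v(1-w)}{v-w}\Big) - \mathrm{Li}_3\Big(\tfrac{v}{v-w}\Big) + \mathrm{Li}_3\Big(\tfrac{v(1-u)}{v-u}\Big) - \mathrm{Li}_3\Big(\tfrac{v}{v-u}\Big)\\ & + \mathrm{Li}_3\Big(\tfrac{u(1-w)}{w(1-u)}\Big) - \mathrm{Li}_3\Big(\tfrac{(v-u)(w-1)}{(v-w)(u-1)}\Big) - \mathrm{Li}_3\Big(\tfrac{u}{w}\Big) + \mathrm{Li}_3\Big(\tfrac{v-u}{v-w}\Big). \end{align*} Here $\log(1-u)$ and $\log(1-w)$ are principal, and all the other logarithms and polylogarithms on the right-hand side are understood by simultaneous analytic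 continuation, as follows. For real $-1\le v<0<u<w<1$ the arguments of these logarithms are positive and the arguments of $\mathrm{Li}_2,\mathrm{Li}_3$ lie in $(0,1)$; there the logarithms are the real ones and $\mathrm{Li}_s(z)=\sum_{n\ge1}z^n/n^s$. Every triple $(u,v,w)$ of pairwise distinct points of $\mathbb D'$ is the endpoint of a continuous path of such triples that starts at a real triple with $-1\le v<0<u<w<1$. Along every such path each of these logarithms and polylogarithms can be continued analytically (along the path traced by its argument), and the formula holds with the values obtained at the endpoint, whichever such path is used. -/

import Mathlib

open Filter Topology unitInterval

noncomputable section

/-- The set `D'` of nonzero complex numbers of modulus at most one, other than `1`. -/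
def discPrime : Set ℂ := {z | z ≠ 0 ∧ ‖z‖ ≤ 1 ∧ z ≠ 1}

/-- The integrand of `F(z; u, v, w)`, with principal logarithms and the principal power `t ^ z`. -/
def hzIntegrand (z u v w : ℂ) (t : ℝ) : ℂ :=
  Complex.log (1 - u * (t : ℂ) ^ z) * Complex.log (1 - w * (t : ℂ) ^ z) / (v⁻¹ - (t : ℂ))

/-- The function `F(z; u, v, w)`. -/
def hzF (z u v w : ℂ) : ℂ := ∫ t in (0 : ℝ)..1, hzIntegrand z u v w t

/-- The polylogarithm series `∑_{n ≥ 1} z ^ n / n ^ s`. It is used only near points of the open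
unit disc; elsewhere the polylogarithm is obtained from it by analytic continuation. -/
def polylogSeries (s : ℕ) (z : ℂ) : ℂ := ∑' n : ℕ, z ^ (n + 1) / ((n + 1 : ℕ) : ℂ) ^ s

/-- `g` is an analytic continuation of (the germ at `c 0` of) `f` along the path `c`:
`g s` represents an analytic germ at `c s`, germs at nearby parameters are direct continuations of
one another, and the germ at the start is that of `f`. -/
structure IsContinuationAlong (f : ℂ → ℂ) (c : I → ℂ) (g : I → ℂ → ℂ) : Prop where
  continuous_path : Continuous c
  analyticAt : ∀ s, AnalyticAt ℂ (g s) (c s)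
  locally_eq : ∀ s, ∀ᶠ s' in 𝓝 s, g s' =ᶠ[𝓝 (c s')] g s
  start_eq : g 0 =ᶠ[𝓝 (c 0)] f

/-- `f` can be continued analytically along the path `c`. -/
def ContinuableAlong (f : ℂ → ℂ) (c : I → ℂ) : Prop := ∃ g, IsContinuationAlong f c g

/-- Two continuations of the same function along the same path have the same germs. -/
theorem IsContinuationAlong.unique {f : ℂ → ℂ} {c : I → ℂ} {g h : I → ℂ → ℂ}
    (hg : IsContinuationAlong f c g) (hh : IsContinuationAlong f c h) (s : I) :
    g s =ᶠ[𝓝 (c s)] h s := by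
  have hc := hg.continuous_path
  have key : IsClopen {s : I | g s =ᶠ[𝓝 (c s)] h s} := by
    constructor
    · rw [← isOpen_compl_iff, isOpen_iff_mem_nhds]
      intro s hs
      have hs' : ¬ (g s =ᶠ[𝓝 (c s)] h s) := hs
      have hne : ∀ᶠ z in 𝓝 (c s), z ≠ c s → g s z ≠ h s z := by
        rcases (hg.analyticAt s).eventually_eq_or_eventually_ne (hh.analyticAt s) with h1 | h1
        · exact absurd h1 hs'
        · exact eventually_nhdsWithin_iff.mp h1
      filter_upwards [hg.locally_eq s, hh.locally_eq s, hc.continuousAt.eventually hne]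
        with s' h1 h2 h3 h4
      have h5 : g s =ᶠ[𝓝 (c s')] h s := h1.symm.trans (EventuallyEq.trans h4 h2)
      by_cases hcs : c s' = c s
      · rw [hcs] at h5
        exact hs' h5
      · exact h3 hcs h5.self_of_nhds
    · rw [isOpen_iff_mem_nhds]
      intro s hs
      have hs' : g s =ᶠ[𝓝 (c s)] h s := hs
      filter_upwards [hg.locally_eq s, hh.locally_eq s,
        hc.continuousAt.eventually hs'.eventually_nhds] with s' h1 h2 h3
      exact h1.trans (EventuallyEq.trans h3 h2.symm)
  have huniv := key.eq_univ ⟨0, hg.start_eq.trans hh.start_eq.symm⟩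
  have : s ∈ {s : I | g s =ᶠ[𝓝 (c s)] h s} := by rw [huniv]; trivial
  exact this

open Classical in
/-- The value at the endpoint `c 1` of the analytic continuation of `f` along the path `c`
(and `0` if `f` cannot be continued along `c`). -/
def continuedValue (f : ℂ → ℂ) (c : I → ℂ) : ℂ :=
  if h : ContinuableAlong f c then h.choose 1 (c 1) else 0

/-- The continued value does not depend on the continuation used to compute it. -/
theorem IsContinuationAlong.continuedValue_eq {f : ℂ → ℂ} {c : I → ℂ} {g : I → ℂ → ℂ}
    (hg : IsContinuationAlong f c g) : continuedValue f c = g 1 (c 1) := by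
  have h : ContinuableAlong f c := ⟨g, hg⟩
  rw [continuedValue, dif_pos h]
  exact (h.choose_spec.unique hg 1).self_of_nhds

/-- The logarithm at the endpoint of the path `c`, continued along `c` from the principal
logarithm. -/
def logAlong (c : I → ℂ) : ℂ := continuedValue Complex.log c

/-- The polylogarithm `Li_s` at the endpoint of the path `c`, continued along `c` from the
power series. -/
def LiAlong (s : ℕ) (c : I → ℂ) : ℂ := continuedValue (polylogSeries s) c

/-- The triple of paths `(u(·), v(·), w(·))` moves continuously through triples of pairwise distinct
points of `D'`, and starts at a real triple with `-1 ≤ v < 0 < u < w < 1`. -/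
structure IsAdmissible (u v w : I → ℂ) : Prop where
  continuous_u : Continuous u
  continuous_v : Continuous v
  continuous_w : Continuous w
  mem_u : ∀ s, u s ∈ discPrime
  mem_v : ∀ s, v s ∈ discPrime
  mem_w : ∀ s, w s ∈ discPrime
  u_ne_v : ∀ s, u s ≠ v s
  v_ne_w : ∀ s, v s ≠ w s
  u_ne_w : ∀ s, u s ≠ w s
  start : ∃ a b c : ℝ, -1 ≤ b ∧ b < 0 ∧ 0 < a ∧ a < c ∧ c < 1 ∧
    u 0 = (a : ℂ) ∧ v 0 = (b : ℂ) ∧ w 0 = (c : ℂ)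

end

/-! The formula is proved on real triples by differentiation and then carried to all of `D'` by
analytic continuation in three complex variables.

Real triples. Put `v = -y`. Substituting `t = x t'` shows that the integral over `[0, x]` is `F(1;
ux, vx, wx)`, so the candidate primitive is the closed form at the rescaled triple. Apart from the
factors `1 - u`, `1 - v`, `1 - w`, its arguments are homogeneous of degree 0 and do not see `x`. As
`d Li_2(X) = -log(1 - X) d log X` and `d Li_3(X) = Li_2(X) d log X`, and as every `1 - X` factors,
the derivative is a polynomial in logarithms, dilogarithms and three logarithmic derivatives, which
collapses to the integrand (`integral_log_mul_log`). The value at `x = 0` vanishes by the five-term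
relation (`realPolylog_two_five_term`).

Continuation. A path avoiding 0 continues `log`, and one avoiding 0 and 1 continues `Li_s`, because
a primitive continues wherever its derivative does (`ContinuableAlong.of_hasDerivAt`). Distinctness
of the three points keeps the arguments away from these singularities. Composing with the arguments
turns the right-hand side into a chain of holomorphic germs on `ℂ³` along the path of triples. The
integral itself is holomorphic near every such triple (`differentiableAt_hzF`). Both sides agree at
the real points near the start, hence near the start (`eventually_eq_zero_of_real`), hence at the
endpoint (`HasContinuedValue.eq`). -/

/-! ### The polylogarithm series and its derivative. -/

lemma summable_polylogSeries_terms (s : ℕ) {z : ℂ} (hz : ‖z‖ < 1) :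
    Summable fun n : ℕ => z ^ (n + 1) / ((n + 1 : ℕ) : ℂ) ^ s := by
  refine Summable.of_norm_bounded (g := fun n : ℕ => ‖z‖ ^ n)
    (summable_geometric_of_lt_one (norm_nonneg _) hz) fun n => ?_
  rw [norm_div, norm_pow, norm_pow, Complex.norm_natCast]
  have h1 : (1 : ℝ) ≤ ((n + 1 : ℕ) : ℝ) ^ s := one_le_pow₀ (by exact_mod_cast Nat.le_add_left 1 n)
  rw [div_le_iff₀ (by linarith)]
  have h2 : ‖z‖ ^ (n + 1) ≤ ‖z‖ ^ n := pow_le_pow_of_le_one (norm_nonneg _) hz.le n.le_succ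
  nlinarith [pow_nonneg (norm_nonneg z) n]

lemma hasDerivAt_polylogSeries (s : ℕ) {z : ℂ} (hz : ‖z‖ < 1) (hz0 : z ≠ 0) :
    HasDerivAt (polylogSeries (s + 1)) (polylogSeries s z / z) z := by
  obtain ⟨r, hzr, hr⟩ := exists_between hz
  have hr0 : 0 ≤ r := (norm_nonneg z).trans hzr.le
  have key := hasDerivAt_tsum_of_isPreconnected (𝕜 := ℂ) (F := ℂ) (y := z) (y₀ := z)
    (t := Metric.ball 0 r)
    (g := fun (n : ℕ) z => z ^ (n + 1) / ((n + 1 : ℕ) : ℂ) ^ (s + 1))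
    (g' := fun (n : ℕ) z => z ^ n / ((n + 1 : ℕ) : ℂ) ^ s) (u := fun n => r ^ n)
    (summable_geometric_of_lt_one hr0 hr) Metric.isOpen_ball
    (convex_ball _ _).isPreconnected (fun n y _ => ?_) (fun n y hy => ?_)
    (by simpa using hzr) (summable_polylogSeries_terms (s + 1) hz) (by simpa using hzr)
  · refine key.congr_deriv ?_
    rw [polylogSeries, ← tsum_div_const]
    refine tsum_congr fun n => ?_
    rw [pow_succ]
    field_simp
  · have hn : ((n + 1 : ℕ) : ℂ) ≠ 0 := by exact_mod_cast n.succ_ne_zero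
    refine ((hasDerivAt_pow (n + 1) y).div_const _).congr_deriv ?_
    rw [pow_succ ((n + 1 : ℕ) : ℂ), Nat.add_sub_cancel]
    field_simp
  · have hy' : ‖y‖ < r := by simpa using hy
    rw [norm_div, norm_pow, norm_pow, Complex.norm_natCast]
    have h1 : (1 : ℝ) ≤ ((n + 1 : ℕ) : ℝ) ^ s :=
      one_le_pow₀ (by exact_mod_cast Nat.le_add_left 1 n)
    rw [div_le_iff₀ (by linarith)]
    have h2 : ‖y‖ ^ n ≤ r ^ n := pow_le_pow_left₀ (norm_nonneg _) hy'.le n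
    nlinarith [pow_nonneg hr0 n]

lemma polylogSeries_zero_left {z : ℂ} (hz : ‖z‖ < 1) : polylogSeries 0 z = z / (1 - z) := by
  simp only [polylogSeries, pow_zero, div_one, pow_succ]
  rw [tsum_mul_right, tsum_geometric_of_norm_lt_one hz]
  ring

/-- The polylogarithm series of a real variable. -/
noncomputable def realPolylog (s : ℕ) (x : ℝ) : ℝ := ∑' n : ℕ, x ^ (n + 1) / ((n + 1 : ℕ) : ℝ) ^ s

lemma polylogSeries_ofReal (s : ℕ) (x : ℝ) : polylogSeries s x = (realPolylog s x : ℂ) := by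
  rw [realPolylog, polylogSeries, Complex.ofReal_tsum]
  push_cast
  rfl

lemma realPolylog_zero_right (s : ℕ) : realPolylog s 0 = 0 := by simp [realPolylog]

lemma realPolylog_one_left {x : ℝ} (hx : |x| < 1) : realPolylog 1 x = -Real.log (1 - x) := by
  have := (Real.hasSum_pow_div_log_of_abs_lt_one hx).tsum_eq
  rw [← this, realPolylog]
  simp

lemma hasDerivAt_realPolylog (s : ℕ) {x : ℝ} (hx : |x| < 1) (hx0 : x ≠ 0) :
    HasDerivAt (realPolylog (s + 1)) (realPolylog s x / x) x := by
  have h := (hasDerivAt_polylogSeries s (z := (x : ℂ)) (by simpa using hx)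
    (by exact_mod_cast hx0)).real_of_complex
  have h1 : (fun y : ℝ => (polylogSeries (s + 1) y).re) = realPolylog (s + 1) := by
    funext y
    rw [polylogSeries_ofReal, Complex.ofReal_re]
  have h2 : (polylogSeries s x / x).re = realPolylog s x / x := by
    rw [polylogSeries_ofReal, ← Complex.ofReal_div, Complex.ofReal_re]
  rwa [h1, h2] at h

/-- Supplies continuity at 0, which `hasDerivAt_realPolylog` excludes; the five-term relation is
anchored there. -/
lemma continuousOn_realPolylog_two : ContinuousOn (realPolylog 2) (Set.Icc 0 1) := by
  have hs : Summable fun n : ℕ => 1 / ((n + 1 : ℕ) : ℝ) ^ 2 :=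
    (summable_nat_add_iff (f := fun n : ℕ => 1 / (n : ℝ) ^ 2) 1).2
      (Real.summable_one_div_nat_pow.2 one_lt_two)
  refine continuousOn_tsum (fun n => by fun_prop) hs fun n x hx => ?_
  rw [Real.norm_of_nonneg (div_nonneg (pow_nonneg hx.1 _) (by positivity))]
  gcongr
  exact pow_le_one₀ hx.1 hx.2

/-! ### Continuation of logarithms and polylogarithms along a path. -/

/-- Local primitives on the unit interval, determined up to locally constant functions, glue to a
global one. -/
lemma exists_eventually_sub_eq (h : I → I → ℂ)
    (compat : ∀ s, ∀ᶠ s' in 𝓝 s, ∀ᶠ t in 𝓝 s', h s t - h s s' = h s' t - h s' s') (a : ℂ) :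
    ∃ φ : I → ℂ, φ 0 = a ∧ ∀ s, ∀ᶠ t in 𝓝 s, φ t - φ s = h s t - h s s := by
  let T : Set I := {s | ∃ φ : I → ℂ, φ 0 = a ∧
    ∀ r ≤ s, ∀ᶠ t in 𝓝 r, t ≤ s → φ t - φ r = h r t - h r r}
  -- Membership in `T` is locally constant: near `s₀` the single primitive `h s₀` extends any `φ`
  -- that reaches a nearby `s`. Hence `T` is clopen.
  have step : ∀ s₀ : I, ∃ N ∈ 𝓝 s₀, ∀ s ∈ N, ∀ s' ∈ N, s ∈ T → s' ∈ T := by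
    intro s₀
    obtain ⟨ε, hε, hN⟩ := Metric.eventually_nhds_iff.1 (compat s₀)
    refine ⟨Metric.ball s₀ ε, Metric.ball_mem_nhds _ hε, ?_⟩
    rintro s hs s' hs' ⟨φ, hφ0, hφ⟩
    rcases le_or_gt s' s with hle | hlt
    · refine ⟨φ, hφ0, fun r hr => ?_⟩
      filter_upwards [hφ r (hr.trans hle)] with t ht hts using ht (hts.trans hle)
    have hmem : ∀ r, s ≤ r → r ≤ s' → dist r s₀ < ε := by
      intro r h1 h2
      have h1' : (s : ℝ) ≤ r := h1
      have h2' : (r : ℝ) ≤ s' := h2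
      rw [Metric.mem_ball, Subtype.dist_eq, Real.dist_eq, abs_lt] at hs hs'
      rw [Subtype.dist_eq, Real.dist_eq, abs_lt]
      constructor <;> linarith [hs.1, hs'.2]
    refine ⟨fun t => if t ≤ s then φ t else φ s + (h s₀ t - h s₀ s), by simp [hφ0],
      fun r hr => ?_⟩
    rcases lt_trichotomy r s with hrs | rfl | hrs
    · filter_upwards [hφ r hrs.le, eventually_lt_nhds hrs] with t ht hts _
      simp only [hts.le, hrs.le, if_true]
      exact ht hts.le
    · filter_upwards [hφ r le_rfl, hN hs] with t ht ht' _
      by_cases htr : t ≤ r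
      · simpa [htr] using ht htr
      · simpa [htr] using ht'
    · filter_upwards [hN (hmem r hrs.le hr), eventually_gt_nhds hrs] with t ht hts _
      simp only [not_le.2 hts, not_le.2 hrs, if_false]
      rw [← ht]
      ring
  have hT : IsClopen T := by
    refine ⟨⟨isOpen_iff_mem_nhds.2 fun s hs => ?_⟩, isOpen_iff_mem_nhds.2 fun s hs => ?_⟩
    · obtain ⟨N, hN, hst⟩ := step s
      filter_upwards [hN] with s' hs' hs'T using hs (hst s' hs' s (mem_of_mem_nhds hN) hs'T)
    · obtain ⟨N, hN, hst⟩ := step s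
      filter_upwards [hN] with s' hs' using hst s (mem_of_mem_nhds hN) s' hs' hs
  have h0 : (0 : I) ∈ T := by
    refine ⟨fun _ => a, rfl, fun r hr => Eventually.of_forall fun t ht => ?_⟩
    rw [le_antisymm hr unitInterval.nonneg', le_antisymm ht unitInterval.nonneg', sub_self, sub_self]
  have h1 : (1 : I) ∈ T := by rw [hT.eq_univ ⟨0, h0⟩]; trivial
  obtain ⟨φ, hφ0, hφ⟩ := h1
  refine ⟨φ, hφ0, fun s => ?_⟩
  filter_upwards [hφ s unitInterval.le_one'] with t ht using ht unitInterval.le_one'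

lemma eventually_sub_eq_of_hasDerivAt {F G k l : ℂ → ℂ} {z : ℂ}
    (hF : ∀ᶠ x in 𝓝 z, HasDerivAt F (k x) x) (hG : ∀ᶠ x in 𝓝 z, HasDerivAt G (l x) x)
    (h : k =ᶠ[𝓝 z] l) : ∀ᶠ x in 𝓝 z, F x - F z = G x - G z := by
  obtain ⟨ε, hε, hb⟩ := Metric.eventually_nhds_iff_ball.1 (hF.and (hG.and h))
  filter_upwards [Metric.ball_mem_nhds z hε] with x hx
  have h1 : ∀ y ∈ Metric.ball z ε, HasDerivWithinAt (fun y => F y - G y) 0 (Metric.ball z ε) y := by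
    intro y hy
    obtain ⟨h1, h2, h3⟩ := hb y hy
    exact ((h1.sub h2).congr_deriv (sub_eq_zero.2 h3)).hasDerivWithinAt
  have h2 := (convex_ball z ε).is_const_of_fderivWithin_eq_zero (𝕜 := ℂ)
    (f := fun y => F y - G y) (fun y hy => (h1 y hy).differentiableWithinAt) (fun y hy => by
      have := (h1 y hy).hasFDerivWithinAt.fderivWithin (Metric.isOpen_ball.uniqueDiffWithinAt hy)
      rw [this]
      ext
      simp) hx (Metric.mem_ball_self hε)
  linear_combination h2

/-- If the derivative of `f` can be continued along a path, then so can `f`. -/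
lemma ContinuableAlong.of_hasDerivAt {f k : ℂ → ℂ} {c : I → ℂ} (hk : ContinuableAlong k c)
    (hf : ∀ᶠ z in 𝓝 (c 0), HasDerivAt f (k z) z) : ContinuableAlong f c := by
  obtain ⟨g, hg⟩ := hk
  have hc := hg.continuous_path
  have hH : ∀ s, ∃ H : ℂ → ℂ, ∀ᶠ z in 𝓝 (c s), HasDerivAt H (g s z) z := by
    intro s
    obtain ⟨ε, hε, hb⟩ := Metric.eventually_nhds_iff_ball.1 (hg.analyticAt s).eventually_analyticAt
    have hd : DifferentiableOn ℂ (g s) (Metric.ball (c s) ε) := fun z hz =>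
      (hb z hz).differentiableAt.differentiableWithinAt
    obtain ⟨H, hH⟩ := hd.isExactOn_ball
    exact ⟨H, eventually_of_mem (Metric.ball_mem_nhds _ hε) hH⟩
  choose H hH using hH
  have hHs : ∀ s, ∀ᶠ s' in 𝓝 s, ∀ᶠ z in 𝓝 (c s'), H s z - H s (c s') = H s' z - H s' (c s') := by
    intro s
    filter_upwards [hc.continuousAt.eventually (hH s).eventually_nhds, hg.locally_eq s] with s' h1 h2
    exact eventually_sub_eq_of_hasDerivAt h1 (hH s') h2.symm
  -- `φ s` is the value the continuation must take at `c s`; it fixes the constant of integration of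
  -- each local primitive `H s`.
  obtain ⟨φ, hφ0, hφ⟩ := exists_eventually_sub_eq (fun s t => H s (c t))
    (fun s => (hHs s).mono fun s' h => hc.continuousAt.eventually h) (f (c 0))
  refine ⟨fun s z => φ s + (H s z - H s (c s)), hc, fun s => ?_, fun s => ?_, ?_⟩
  · refine analyticAt_const.add (AnalyticAt.sub ?_ analyticAt_const)
    exact Complex.analyticAt_iff_eventually_differentiableAt.2
      ((hH s).mono fun z hz => hz.differentiableAt)
  · filter_upwards [hHs s, hφ s] with s' h1 h2
    filter_upwards [h1] with z hz
    linear_combination h2 - hz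
  · filter_upwards [eventually_sub_eq_of_hasDerivAt (hH 0) hf hg.start_eq] with z hz
    rw [hφ0, hz]
    ring

lemma ContinuableAlong.of_analyticAt {f : ℂ → ℂ} {c : I → ℂ} (hc : Continuous c)
    (hf : ∀ s, AnalyticAt ℂ f (c s)) : ContinuableAlong f c :=
  ⟨fun _ => f, hc, hf, fun _ => Eventually.of_forall fun _ => EventuallyEq.rfl, EventuallyEq.rfl⟩

lemma ContinuableAlong.congr {f g : ℂ → ℂ} {c : I → ℂ} (hf : ContinuableAlong f c)
    (h : f =ᶠ[𝓝 (c 0)] g) : ContinuableAlong g c := by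
  obtain ⟨G, hG⟩ := hf
  exact ⟨G, hG.1, hG.2, hG.3, hG.4.trans h⟩

lemma ContinuableAlong.div_analyticAt {f k : ℂ → ℂ} {c : I → ℂ} (hf : ContinuableAlong f c)
    (hk : ∀ s, AnalyticAt ℂ k (c s)) (hk0 : ∀ s, k (c s) ≠ 0) :
    ContinuableAlong (fun z => f z / k z) c := by
  obtain ⟨G, hG⟩ := hf
  refine ⟨fun s z => G s z / k z, hG.1, fun s => (hG.2 s).div (hk s) (hk0 s), fun s => ?_, ?_⟩
  · filter_upwards [hG.3 s] with s' h using h.div EventuallyEq.rfl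
  · exact hG.4.div EventuallyEq.rfl

/-- The derivative `1/z` is single-valued off 0, so the path may wind around 0 freely. The slit
plane matters only at the start, where the germ is the principal one. -/
lemma continuableAlong_log {c : I → ℂ} (hc : Continuous c) (h0 : ∀ s, c s ≠ 0)
    (hs : c 0 ∈ Complex.slitPlane) : ContinuableAlong Complex.log c := by
  refine ContinuableAlong.of_hasDerivAt (k := fun z => z⁻¹)
    (.of_analyticAt hc fun s => analyticAt_inv (h0 s)) ?_
  filter_upwards [Complex.isOpen_slitPlane.mem_nhds hs] with z hz using Complex.hasDerivAt_log hz

/-- Induction on the order: `Li_0 = z / (1 - z)` is singular only at 1, and each integration of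
`Li_n / z` adds only the singularity 0. -/
lemma continuableAlong_polylogSeries (n : ℕ) {c : I → ℂ} (hc : Continuous c) (h0 : ∀ s, c s ≠ 0)
    (h1 : ∀ s, c s ≠ 1) (hs : ‖c 0‖ < 1) : ContinuableAlong (polylogSeries n) c := by
  have hb : ∀ᶠ z in 𝓝 (c 0), ‖z‖ < 1 := continuous_norm.continuousAt.eventually_lt_const hs
  induction n with
  | zero =>
    refine (ContinuableAlong.of_analyticAt (f := fun z => z / (1 - z)) hc fun s => ?_).congr ?_
    · exact analyticAt_id.div (analyticAt_const.sub analyticAt_id) (sub_ne_zero.2 (h1 s).symm)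
    · filter_upwards [hb] with z hz using (polylogSeries_zero_left hz).symm
  | succ n ih =>
    refine (ih.div_analyticAt (k := fun z => z) (fun s => analyticAt_id) h0).of_hasDerivAt ?_
    filter_upwards [hb, isOpen_ne.mem_nhds (h0 0)] with z hz hz0
    exact hasDerivAt_polylogSeries n hz hz0

/-! ### Continuation of holomorphic germs along a path in a normed space, and identity theorems. -/

section ContinuedValue

variable {E : Type*} [NormedAddCommGroup E] [NormedSpace ℂ E]

/-- The germ of `F` at `p 0` can be continued holomorphically along the path `p`, with value `y` at
the endpoint. -/
def HasContinuedValue (p : I → E) (F : E → ℂ) (y : ℂ) : Prop :=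
  ∃ Φ : I → E → ℂ, (∀ s, ∀ᶠ q in 𝓝 (p s), DifferentiableAt ℂ (Φ s) q) ∧
    (∀ s, ∀ᶠ s' in 𝓝 s, Φ s' =ᶠ[𝓝 (p s')] Φ s) ∧ Φ 0 =ᶠ[𝓝 (p 0)] F ∧ Φ 1 (p 1) = y

variable {p : I → E} {F G : E → ℂ} {a b : ℂ}

lemma HasContinuedValue.add (hF : HasContinuedValue p F a) (hG : HasContinuedValue p G b) :
    HasContinuedValue p (fun q => F q + G q) (a + b) := by
  obtain ⟨Φ, h1, h2, h3, h4⟩ := hF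
  obtain ⟨Ψ, k1, k2, k3, k4⟩ := hG
  refine ⟨fun s q => Φ s q + Ψ s q, fun s => ?_, fun s => ?_, h3.add k3, by simp only [h4, k4]⟩
  · filter_upwards [h1 s, k1 s] with q x y using x.add y
  · filter_upwards [h2 s, k2 s] with q x y using x.add y

lemma HasContinuedValue.sub (hF : HasContinuedValue p F a) (hG : HasContinuedValue p G b) :
    HasContinuedValue p (fun q => F q - G q) (a - b) := by
  obtain ⟨Φ, h1, h2, h3, h4⟩ := hF
  obtain ⟨Ψ, k1, k2, k3, k4⟩ := hG
  refine ⟨fun s q => Φ s q - Ψ s q, fun s => ?_, fun s => ?_, h3.sub k3, by simp only [h4, k4]⟩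
  · filter_upwards [h1 s, k1 s] with q x y using x.sub y
  · filter_upwards [h2 s, k2 s] with q x y using x.sub y

lemma HasContinuedValue.mul (hF : HasContinuedValue p F a) (hG : HasContinuedValue p G b) :
    HasContinuedValue p (fun q => F q * G q) (a * b) := by
  obtain ⟨Φ, h1, h2, h3, h4⟩ := hF
  obtain ⟨Ψ, k1, k2, k3, k4⟩ := hG
  refine ⟨fun s q => Φ s q * Ψ s q, fun s => ?_, fun s => ?_, h3.mul k3, by simp only [h4, k4]⟩
  · filter_upwards [h1 s, k1 s] with q x y using x.mul y
  · filter_upwards [h2 s, k2 s] with q x y using x.mul y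

lemma HasContinuedValue.sq (hF : HasContinuedValue p F a) :
    HasContinuedValue p (fun q => F q ^ 2) (a ^ 2) := by
  simp only [_root_.sq]
  exact hF.mul hF

lemma HasContinuedValue.eventually_differentiableAt (hF : HasContinuedValue p F a) :
    ∀ᶠ q in 𝓝 (p 0), DifferentiableAt ℂ F q := by
  obtain ⟨Φ, h1, -, h3, -⟩ := hF
  filter_upwards [h1 0, h3.eventuallyEq_nhds] with q hq hq'
  exact hq.congr_of_eventuallyEq hq'.symm

lemma HasContinuedValue.of_differentiableAt
    (hF : ∀ s, ∀ᶠ q in 𝓝 (p s), DifferentiableAt ℂ F q) : HasContinuedValue p F (F (p 1)) :=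
  ⟨fun _ => F, hF, fun _ => Eventually.of_forall fun _ => EventuallyEq.rfl, EventuallyEq.rfl, rfl⟩

lemma hasContinuedValue_const : HasContinuedValue p (fun _ => a) a :=
  .of_differentiableAt (F := fun _ => a) fun _ =>
    Eventually.of_forall fun _ => differentiableAt_const a

/-- Bridge from one variable to several: a continuation along the path traced by the argument `A`
pulls back through `A`. Terms with different arguments thereby become germs on the same space and
can be added and multiplied. -/
lemma hasContinuedValue_continuedValue {f : ℂ → ℂ} {A : E → ℂ} {c : I → ℂ}
    (hc : ∀ s, c s = A (p s)) (hf : ContinuableAlong f c)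
    (hA : ∀ s, ∀ᶠ q in 𝓝 (p s), DifferentiableAt ℂ A q) :
    HasContinuedValue p (fun q => f (A q)) (continuedValue f c) := by
  obtain ⟨g, hg⟩ := hf
  have hAc : ∀ s, Tendsto A (𝓝 (p s)) (𝓝 (c s)) := fun s => by
    rw [hc]
    exact (hA s).self_of_nhds.continuousAt
  refine ⟨fun s q => g s (A q), fun s => ?_, fun s => ?_, (hAc 0).eventually hg.start_eq, ?_⟩
  · filter_upwards [hA s, (hAc s).eventually (hg.analyticAt s).eventually_analyticAt] with q h1 h2
    exact h2.differentiableAt.comp q h1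
  · filter_upwards [hg.locally_eq s] with s' h using (hAc s').eventually h
  · simp only [hg.continuedValue_eq, hc]

/-- A holomorphic function on a ball that vanishes near one of its points vanishes. -/
lemma eq_zero_of_differentiableOn_ball {F : E → ℂ} {q₀ : E} {r : ℝ}
    (hF : ∀ q ∈ Metric.ball q₀ r, DifferentiableAt ℂ F q) {q₁ : E} (h₁ : q₁ ∈ Metric.ball q₀ r)
    (h : ∀ᶠ q in 𝓝 q₁, F q = 0) {q : E} (hq : q ∈ Metric.ball q₀ r) : F q = 0 := by
  -- The complex line through `q₁` and `q` meets the ball in a convex open set, so the one-variable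
  -- identity theorem applies.
  let l : ℂ → E := fun z => q₁ + z • (q - q₁)
  have hl : Differentiable ℂ l := by fun_prop
  let U : Set ℂ := l ⁻¹' Metric.ball q₀ r
  have hU : IsOpen U := Metric.isOpen_ball.preimage hl.continuous
  have hUc : Convex ℝ U := by
    intro x hx y hy s t hs ht hst
    have : l (s • x + t • y) = s • l x + t • l y := by
      simp only [l, smul_add, add_smul, smul_assoc]
      have hst' : q₁ = s • q₁ + t • q₁ := by rw [← add_smul, hst, one_smul]
      nth_rewrite 1 [hst']
      abel
    change l (s • x + t • y) ∈ Metric.ball q₀ r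
    rw [this]
    exact convex_ball q₀ r hx hy hs ht hst
  have han : AnalyticOnNhd ℂ (fun z => F (l z)) U := by
    refine DifferentiableOn.analyticOnNhd (fun z hz => ?_) hU
    exact ((hF _ hz).comp z (hl z)).differentiableWithinAt
  have h0 : (0 : ℂ) ∈ U := by simpa [U, l] using h₁
  have h1 : (1 : ℂ) ∈ U := by simpa [U, l] using hq
  have hz : (fun z => F (l z)) =ᶠ[𝓝 0] 0 := by
    have ht : Tendsto l (𝓝 0) (𝓝 q₁) := by
      have := hl.continuous.tendsto 0
      simpa [l] using this
    exact ht.eventually h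
  have := han.eqOn_zero_of_preconnected_of_eventuallyEq_zero hUc.isPreconnected h0 hz h1
  simpa [l] using this

lemma HasContinuedValue.eq (hp : Continuous p) (hF : HasContinuedValue p F a)
    (hG : HasContinuedValue p G b) (h : F =ᶠ[𝓝 (p 0)] G) : a = b := by
  obtain ⟨Φ, h1, h2, h3, h4⟩ := hF.sub hG
  -- Closedness is the identity theorem: if the germ of the difference vanishes at parameters
  -- arbitrarily close to `s`, then `Φ s` vanishes near some point of a ball on which it is
  -- holomorphic, hence on the whole ball.
  have hT : IsClopen {s | ∀ᶠ q in 𝓝 (p s), Φ s q = 0} := by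
    refine ⟨⟨isOpen_iff_mem_nhds.2 fun s hs => ?_⟩, isOpen_iff_mem_nhds.2 fun s hs => ?_⟩
    · obtain ⟨r, hr, hb⟩ := Metric.eventually_nhds_iff_ball.1 (h1 s)
      filter_upwards [h2 s, hp.continuousAt.eventually (Metric.ball_mem_nhds (p s) hr)]
        with s' hs' hb' hs0
      refine hs (eventually_of_mem (Metric.ball_mem_nhds _ hr) fun q hq => ?_)
      refine eq_zero_of_differentiableOn_ball hb hb' ?_ hq
      filter_upwards [hs', hs0] with q x y using x ▸ y
    · filter_upwards [h2 s, hp.continuousAt.eventually (Eventually.eventually_nhds hs)] with s' h h'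
      filter_upwards [h, h'] with q x y using x.trans y
  have h0 : (0 : I) ∈ {s | ∀ᶠ q in 𝓝 (p s), Φ s q = 0} := by
    filter_upwards [h3, h] with q x y
    rw [x, y, sub_self]
  have h1 : (1 : I) ∈ {s | ∀ᶠ q in 𝓝 (p s), Φ s q = 0} := by rw [hT.eq_univ ⟨0, h0⟩]; trivial
  have h1' : ∀ᶠ q in 𝓝 (p 1), Φ 1 q = 0 := h1
  exact sub_eq_zero.1 (h4.symm.trans h1'.self_of_nhds)

end ContinuedValue

/-- A holomorphic function of three variables that vanishes at the real points near a real point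
vanishes near it. -/
lemma eventually_eq_zero_of_real {F : ℂ × ℂ × ℂ → ℂ} {a b c : ℝ}
    (hF : ∀ᶠ q in 𝓝 ((a : ℂ), (b : ℂ), (c : ℂ)), DifferentiableAt ℂ F q)
    (h : ∀ᶠ x in 𝓝 (a, b, c), F ((x.1 : ℂ), (x.2.1 : ℂ), (x.2.2 : ℂ)) = 0) :
    ∀ᶠ q in 𝓝 ((a : ℂ), (b : ℂ), (c : ℂ)), F q = 0 := by
  -- The complex line `Re q + z Im q` is real for real `z` and passes through `q` at `z = I`.
  -- Vanishing at small real `z` thus propagates to `q`.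
  let l : ℂ × ℂ × ℂ → ℂ → ℂ × ℂ × ℂ := fun q z =>
    ((q.1.re : ℂ) + z * q.1.im, (q.2.1.re : ℂ) + z * q.2.1.im, (q.2.2.re : ℂ) + z * q.2.2.im)
  let lr : ℂ × ℂ × ℂ → ℝ → ℝ × ℝ × ℝ := fun q t =>
    (q.1.re + t * q.1.im, q.2.1.re + t * q.2.1.im, q.2.2.re + t * q.2.2.im)
  have hK : IsCompact (Metric.closedBall (0 : ℂ) 1) := isCompact_closedBall 0 1
  -- At the real base point the imaginary parts vanish and the line is constant; compactness of the
  -- disc then keeps the nearby lines inside the domain of holomorphy.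
  have h1 : ∀ᶠ q in 𝓝 ((a : ℂ), (b : ℂ), (c : ℂ)), ∀ z ∈ Metric.closedBall (0 : ℂ) 1,
      ∀ᶠ q' in 𝓝 (l q z), DifferentiableAt ℂ F q' := by
    refine hK.eventually_forall_of_forall_eventually fun z _ => ?_
    have hc : Continuous fun x : (ℂ × ℂ × ℂ) × ℂ => l x.1 x.2 := by fun_prop
    have := hc.tendsto (((a : ℂ), (b : ℂ), (c : ℂ)), z)
    simp only [l, Complex.ofReal_re, Complex.ofReal_im, Complex.ofReal_zero, mul_zero,
      add_zero] at this
    exact this.eventually hF.eventually_nhds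
  have h2 : ∀ᶠ q in 𝓝 ((a : ℂ), (b : ℂ), (c : ℂ)), ∀ᶠ t in 𝓝 (0 : ℝ),
      F (((lr q t).1 : ℂ), ((lr q t).2.1 : ℂ), ((lr q t).2.2 : ℂ)) = 0 := by
    have hc : Continuous fun x : (ℂ × ℂ × ℂ) × ℝ => lr x.1 x.2 := by fun_prop
    have := hc.tendsto (((a : ℂ), (b : ℂ), (c : ℂ)), 0)
    simp only [lr, Complex.ofReal_re, Complex.ofReal_im, mul_zero, add_zero] at this
    have h3 := this.eventually h
    rw [nhds_prod_eq] at h3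
    exact h3.curry
  filter_upwards [h1, h2] with q hq1 hq2
  have han : AnalyticOnNhd ℂ (fun z => F (l q z)) (Metric.closedBall 0 1) := by
    intro z hz
    refine Complex.analyticAt_iff_eventually_differentiableAt.2 ?_
    have hl : Differentiable ℂ (l q) := by fun_prop
    filter_upwards [hl.continuous.continuousAt.eventually (hq1 z hz)] with w hw
      using hw.comp w (hl w)
  have hfreq : ∃ᶠ z in 𝓝[≠] (0 : ℂ), F (l q z) = 0 := by
    have ht : Tendsto (fun t : ℝ => (t : ℂ)) (𝓝[≠] 0) (𝓝[≠] 0) := by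
      refine tendsto_nhdsWithin_iff.2 ⟨?_, ?_⟩
      · exact (Complex.continuous_ofReal.tendsto' 0 0 Complex.ofReal_zero).mono_left
          nhdsWithin_le_nhds
      · filter_upwards [self_mem_nhdsWithin] with t ht
        simpa using ht
    refine ht.frequently (Eventually.frequently ?_)
    filter_upwards [hq2.filter_mono nhdsWithin_le_nhds] with t ht
    simpa [l, lr] using ht
  have := han.eqOn_zero_of_preconnected_of_frequently_eq_zero
    (convex_closedBall _ _).isPreconnected (by simp) hfreq
    (show Complex.I ∈ Metric.closedBall (0 : ℂ) 1 by simp)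
  have hI : l q Complex.I = q := by
    simp only [l]
    refine Prod.ext ?_ (Prod.ext ?_ ?_) <;> simp [Complex.ext_iff]
  simpa [hI] using this

/-! ### Holomorphy of the integral in `(u, v, w)`. -/

lemma one_sub_mem_slitPlane {z : ℂ} (hz : z ∈ discPrime) : 1 - z ∈ Complex.slitPlane := by
  obtain ⟨_, h1, h2⟩ := hz
  left
  have h3 := Complex.re_le_norm z
  rcases h3.lt_or_eq with h | h
  · simp only [Complex.sub_re, Complex.one_re]
    linarith
  · rcases h1.lt_or_eq with h' | h'
    · simp only [Complex.sub_re, Complex.one_re]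
      linarith
    · exfalso
      have h4 := Complex.re_eq_norm.1 h
      rw [Complex.le_def] at h4
      refine h2 (Complex.ext ?_ ?_)
      · simp [h, h']
      · simp [← h4.2]

/-- The slit plane is star-shaped about 1, so the condition at `t = 1` controls the whole interval.
It serves both logarithms and, through `1 - v t ≠ 0`, the denominator. -/
lemma one_sub_mul_mem_slitPlane {z : ℂ} (hz : 1 - z ∈ Complex.slitPlane) {t : ℝ}
    (ht : t ∈ Set.Icc (0 : ℝ) 1) : 1 - z * t ∈ Complex.slitPlane := by
  have := Complex.starConvex_one_slitPlane.add_smul_sub_mem hz ht.1 ht.2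
  convert this using 1
  simp only [Complex.real_smul]
  ring

/-- The triples of three complex numbers outside `[1, ∞)`, the second of which is not zero. -/
def hzDomain : Set (ℂ × ℂ × ℂ) :=
  {q | 1 - q.1 ∈ Complex.slitPlane ∧ 1 - q.2.1 ∈ Complex.slitPlane ∧
    1 - q.2.2 ∈ Complex.slitPlane ∧ q.2.1 ≠ 0}

lemma isOpen_hzDomain : IsOpen hzDomain := by
  have h := Complex.isOpen_slitPlane
  exact (h.preimage (by fun_prop)).inter ((h.preimage (by fun_prop)).inter
    ((h.preimage (by fun_prop)).inter (isOpen_ne.preimage (by fun_prop))))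

/-- The integrand of `F(1; u, v, w)` as a function of all its variables. -/
noncomputable def hzKernel (x : (ℂ × ℂ × ℂ) × ℂ) : ℂ :=
  Complex.log (1 - x.1.1 * x.2) * Complex.log (1 - x.1.2.2 * x.2) / (x.1.2.1⁻¹ - x.2)

lemma hzIntegrand_one (q : ℂ × ℂ × ℂ) (t : ℝ) :
    hzIntegrand 1 q.1 q.2.1 q.2.2 t = hzKernel (q, t) := by
  simp [hzIntegrand, hzKernel]

lemma inv_sub_ne_zero {v : ℂ} (hv : 1 - v ∈ Complex.slitPlane) (hv0 : v ≠ 0) {t : ℝ}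
    (ht : t ∈ Set.Icc (0 : ℝ) 1) : v⁻¹ - t ≠ 0 := by
  intro h
  refine Complex.slitPlane_ne_zero (one_sub_mul_mem_slitPlane hv ht) ?_
  rw [← sub_eq_zero.1 h, mul_inv_cancel₀ hv0, sub_self]

lemma contDiffAt_hzKernel {q : ℂ × ℂ × ℂ} (hq : q ∈ hzDomain) {t : ℝ}
    (ht : t ∈ Set.Icc (0 : ℝ) 1) : ContDiffAt ℂ 2 hzKernel (q, (t : ℂ)) := by
  obtain ⟨h1, h2, h3, h4⟩ := hq
  refine ContDiffAt.div (ContDiffAt.mul ?_ ?_) ?_ (inv_sub_ne_zero h2 h4 ht)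
  · exact (Complex.contDiffAt_log (one_sub_mul_mem_slitPlane h1 ht)).comp
      (f := fun x : (ℂ × ℂ × ℂ) × ℂ => 1 - x.1.1 * x.2) (q, (t : ℂ)) (by fun_prop)
  · exact (Complex.contDiffAt_log (one_sub_mul_mem_slitPlane h3 ht)).comp
      (f := fun x : (ℂ × ℂ × ℂ) × ℂ => 1 - x.1.2.2 * x.2) (q, (t : ℂ)) (by fun_prop)
  · exact ContDiffAt.sub (ContDiffAt.inv (by fun_prop) h4) (by fun_prop)

lemma continuousOn_hzKernel {q : ℂ × ℂ × ℂ} (hq : q ∈ hzDomain) :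
    ContinuousOn (fun t : ℝ => hzKernel (q, (t : ℂ))) (Set.uIcc 0 1) := by
  intro t ht
  rw [Set.uIcc_of_le zero_le_one] at ht
  have h := (contDiffAt_hzKernel hq ht).continuousAt
  exact (ContinuousAt.comp (f := fun t : ℝ => (q, (t : ℂ))) (x := t) h
    (by fun_prop)).continuousWithinAt

lemma intervalIntegrable_hzIntegrand {q : ℂ × ℂ × ℂ} (hq : q ∈ hzDomain) :
    IntervalIntegrable (hzIntegrand 1 q.1 q.2.1 q.2.2) MeasureTheory.volume 0 1 := by
  have : hzIntegrand 1 q.1 q.2.1 q.2.2 = fun t : ℝ => hzKernel (q, (t : ℂ)) :=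
    funext (hzIntegrand_one q)
  rw [this]
  exact (continuousOn_hzKernel hq).intervalIntegrable

/-- Differentiation under the integral sign: the derivative of the kernel in `q` is jointly
continuous, hence bounded on a closed ball times `[0, 1]`. -/
lemma differentiableAt_hzF {q : ℂ × ℂ × ℂ} (hq : q ∈ hzDomain) :
    DifferentiableAt ℂ (fun q : ℂ × ℂ × ℂ => hzF 1 q.1 q.2.1 q.2.2) q := by
  obtain ⟨r, hr, hb⟩ := Metric.isOpen_iff.1 isOpen_hzDomain q hq
  have hS : Metric.closedBall q (r / 2) ⊆ hzDomain :=
    (Metric.closedBall_subset_ball (by linarith)).trans hb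
  let D : ℂ × ℂ × ℂ → ℝ → ℂ × ℂ × ℂ →L[ℂ] ℂ := fun x t =>
    (fderiv ℂ hzKernel (x, (t : ℂ))).comp (ContinuousLinearMap.inl ℂ (ℂ × ℂ × ℂ) ℂ)
  have hDc : ∀ x ∈ hzDomain, ∀ t ∈ Set.Icc (0 : ℝ) 1,
      ContinuousAt (fun y : (ℂ × ℂ × ℂ) × ℝ => D y.1 y.2) (x, t) := by
    intro x hx t ht
    have h1 : ContinuousAt (fderiv ℂ hzKernel) (x, (t : ℂ)) :=
      ((contDiffAt_hzKernel hx ht).fderiv_right (m := 1) (by norm_num)).continuousAt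
    have h2 : ContinuousAt (fun y : (ℂ × ℂ × ℂ) × ℝ => fderiv ℂ hzKernel (y.1, (y.2 : ℂ))) (x, t) :=
      ContinuousAt.comp (f := fun y : (ℂ × ℂ × ℂ) × ℝ => (y.1, (y.2 : ℂ))) (x := (x, t)) h1
        (by fun_prop)
    exact h2.clm_comp continuousAt_const
  obtain ⟨C, hC⟩ := ((isCompact_closedBall q (r / 2)).prod
    (isCompact_Icc (a := (0 : ℝ)) (b := 1))).exists_bound_of_continuousOn
    (f := fun y : (ℂ × ℂ × ℂ) × ℝ => D y.1 y.2)
    fun y hy => (hDc y.1 (hS hy.1) y.2 hy.2).continuousWithinAt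
  have hsub : Set.uIoc (0 : ℝ) 1 ⊆ Set.Icc 0 1 := by
    rw [Set.uIoc_of_le zero_le_one]
    exact Set.Ioc_subset_Icc_self
  have hball : Metric.closedBall q (r / 2) ∈ 𝓝 q := Metric.closedBall_mem_nhds q (by linarith)
  have key := intervalIntegral.hasFDerivAt_integral_of_dominated_of_fderiv_le (𝕜 := ℂ)
    (μ := MeasureTheory.volume) (a := 0) (b := 1) (x₀ := q) (bound := fun _ => C)
    (F := fun x t => hzKernel (x, (t : ℂ))) (F' := D) hball
    (by
      filter_upwards [hball] with x hx
      exact (continuousOn_hzKernel (hS hx)).intervalIntegrable.def'.aestronglyMeasurable)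
    (continuousOn_hzKernel hq).intervalIntegrable
    (by
      have : ContinuousOn (D q) (Set.uIcc 0 1) := fun t ht => by
        rw [Set.uIcc_of_le zero_le_one] at ht
        exact (ContinuousAt.comp (f := fun t : ℝ => (q, t)) (x := t) (hDc q hq t ht)
          (by fun_prop)).continuousWithinAt
      exact this.intervalIntegrable.def'.aestronglyMeasurable)
    (Eventually.of_forall fun t ht x hx => hC (x, t) ⟨hx, hsub ht⟩)
    intervalIntegrable_const
    (Eventually.of_forall fun t ht x hx =>
      HasFDerivAt.comp (g := hzKernel) (f := fun x : ℂ × ℂ × ℂ => (x, (t : ℂ))) x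
        ((contDiffAt_hzKernel (hS hx) (hsub ht)).differentiableAt two_ne_zero).hasFDerivAt
        (hasFDerivAt_prodMk_left x (t : ℂ)))
  refine key.differentiableAt.congr_of_eventuallyEq (Eventually.of_forall fun x => ?_)
  simp only [hzF, hzIntegrand_one]

/-! ### Existence of admissible paths. -/

/-- Interpolate affinely from `(1, -1, 2)` to the target with a complex parameter. Only countably
many parameters produce a zero or a coincidence, and the complement of a countable set in the plane
is path connected. Positive scaling, which preserves nonvanishing and distinctness, then brings the
path into the disc. -/
lemma exists_isAdmissible {u₁ v₁ w₁ : ℂ} (hu : u₁ ∈ discPrime) (hv : v₁ ∈ discPrime)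
    (hw : w₁ ∈ discPrime) (huv : u₁ ≠ v₁) (hvw : v₁ ≠ w₁) (huw : u₁ ≠ w₁) :
    ∃ u v w : I → ℂ, IsAdmissible u v w ∧ u 1 = u₁ ∧ v 1 = v₁ ∧ w 1 = w₁ := by
  have hline : ∀ x y : ℂ, x ≠ 0 → {z : ℂ | x + z * (y - x) = 0}.Countable := by
    intro x y hx
    refine Set.Subsingleton.countable fun z hz z' hz' => ?_
    simp only [Set.mem_ofPred_eq] at hz hz'
    have h : (z - z') * (y - x) = 0 := by linear_combination hz - hz'
    rcases mul_eq_zero.1 h with h | h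
    · exact sub_eq_zero.1 h
    · rw [h, mul_zero, add_zero] at hz
      exact absurd hz hx
  -- Start and end values of `U`, `V`, `W`, `U - V`, `V - W`, `U - W`. The start values are nonzero,
  -- so each affine function has at most one root.
  let B : Set ℂ := ⋃ x ∈ ({((1 : ℂ), u₁), (-1, v₁), (2, w₁), (2, u₁ - v₁), (-3, v₁ - w₁),
    (-1, u₁ - w₁)} : Finset (ℂ × ℂ)), {z | x.1 + z * (x.2 - x.1) = 0}
  have hB : B.Countable := by
    refine Set.Countable.biUnion (Finset.countable_toSet _) fun x hx => hline _ _ ?_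
    simp only [Finset.coe_insert, Finset.coe_singleton, Set.mem_insert_iff,
      Set.mem_singleton_iff] at hx
    rcases hx with rfl | rfl | rfl | rfl | rfl | rfl <;> norm_num
  have hpc := hB.isPathConnected_compl_of_one_lt_rank (by
    rw [Complex.rank_real_complex]
    exact Cardinal.one_lt_two)
  have hmem : ∀ z, z ∈ Bᶜ ↔ (1 + z * (u₁ - 1) ≠ 0 ∧ -1 + z * (v₁ + 1) ≠ 0 ∧
      2 + z * (w₁ - 2) ≠ 0 ∧ 2 + z * (u₁ - v₁ - 2) ≠ 0 ∧ -3 + z * (v₁ - w₁ + 3) ≠ 0 ∧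
      -1 + z * (u₁ - w₁ + 1) ≠ 0) := by
    intro z
    simp [B]
  obtain ⟨γ, hγ⟩ := hpc.joinedIn 0 ((hmem 0).2 (by norm_num)) 1 ((hmem 1).2 (by
    refine ⟨?_, ?_, ?_, ?_, ?_, ?_⟩ <;> ring_nf
    · exact hu.1
    · exact hv.1
    · exact hw.1
    · exact sub_ne_zero.2 huv
    · exact sub_ne_zero.2 hvw
    · exact sub_ne_zero.2 huw))
  let U : I → ℂ := fun s => 1 + γ s * (u₁ - 1)
  let V : I → ℂ := fun s => -1 + γ s * (v₁ + 1)
  let W : I → ℂ := fun s => 2 + γ s * (w₁ - 2)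
  -- The term `1 - s` makes the scaled moduli strictly less than 1 before the endpoint, which also
  -- excludes the value 1. At `s = 1` the scale is 1, and at `s = 0` it is 3, giving `(1/3, -1/3,
  -- 2/3)`.
  let m : I → ℝ := fun s => max 1 (max ‖U s‖ (max ‖V s‖ ‖W s‖)) + (1 - (s : ℝ))
  have hUc : Continuous U := by fun_prop
  have hVc : Continuous V := by fun_prop
  have hWc : Continuous W := by fun_prop
  have hmc : Continuous m := by fun_prop
  have hs1 : ∀ s : I, 0 ≤ 1 - (s : ℝ) := fun s => sub_nonneg.2 s.2.2
  have hm0 : ∀ s, 0 < m s := fun s =>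
    add_pos_of_pos_of_nonneg (lt_of_lt_of_le one_pos (le_max_left _ _)) (hs1 s)
  have hmC : ∀ s, (m s : ℂ) ≠ 0 := fun s => by exact_mod_cast (hm0 s).ne'
  have hU1 : U 1 = u₁ := by simp [U]
  have hV1 : V 1 = v₁ := by simp [V]
  have hW1 : W 1 = w₁ := by simp [W]
  have hm1 : m 1 = 1 := by simp [m, hU1, hV1, hW1, hu.2.1, hv.2.1, hw.2.1]
  have hU0 : U 0 = 1 := by simp [U]
  have hV0 : V 0 = -1 := by simp [V]
  have hW0 : W 0 = 2 := by simp [W]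
  have hm00 : m 0 = 3 := by
    simp [m, hU0, hV0, hW0]
    norm_num
  have hdisc : ∀ (X : I → ℂ) (x : ℂ), X 1 = x → x ∈ discPrime → (∀ s, X s ≠ 0) →
      (∀ s, ‖X s‖ ≤ max 1 (max ‖U s‖ (max ‖V s‖ ‖W s‖))) → ∀ s, X s / m s ∈ discPrime := by
    intro X x hX1 hx hX0 hXm s
    by_cases hs : s = 1
    · rw [hs, hm1, hX1]
      simpa using hx
    · have hlt : ‖X s / m s‖ < 1 := by
        rw [norm_div, Complex.norm_real, Real.norm_of_nonneg (hm0 s).le, div_lt_one (hm0 s)]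
        have : (s : ℝ) < 1 := lt_of_le_of_ne s.2.2 fun h => hs (Subtype.ext h)
        have h2 := hXm s
        simp only [m]
        linarith
      refine ⟨div_ne_zero (hX0 s) (hmC s), hlt.le, fun h => ?_⟩
      rw [h, norm_one] at hlt
      exact lt_irrefl _ hlt
  have hne := fun s => (hmem (γ s)).1 (hγ s)
  refine ⟨fun s => U s / m s, fun s => V s / m s, fun s => W s / m s, ⟨?_, ?_, ?_,
    hdisc U u₁ hU1 hu (fun s => (hne s).1) (fun s => by simp),
    hdisc V v₁ hV1 hv (fun s => (hne s).2.1) (fun s => by simp),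
    hdisc W w₁ hW1 hw (fun s => (hne s).2.2.1) (fun s => by simp), ?_, ?_, ?_,
    1 / 3, -1 / 3, 2 / 3, by norm_num, by norm_num, by norm_num, by norm_num, by norm_num, ?_⟩,
    by simp [hU1, hm1], by simp [hV1, hm1], by simp [hW1, hm1]⟩
  · exact hUc.div (by fun_prop) hmC
  · exact hVc.div (by fun_prop) hmC
  · exact hWc.div (by fun_prop) hmC
  · intro s h
    rw [div_left_inj' (hmC s)] at h
    refine (hne s).2.2.2.1 ?_
    simp only [U, V] at h
    linear_combination h
  · intro s h
    rw [div_left_inj' (hmC s)] at h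
    refine (hne s).2.2.2.2.1 ?_
    simp only [W, V] at h
    linear_combination h
  · intro s h
    rw [div_left_inj' (hmC s)] at h
    refine (hne s).2.2.2.2.2 ?_
    simp only [W, U] at h
    linear_combination h
  · simp [hU0, hV0, hW0, hm00]

/-! ### The closed form at real triples. -/

/-- Here `d` is the logarithmic derivative of `X`, and `l` allows `log (1 - X)` to be supplied
already expanded, so that derivative identities reduce to `ring`. -/
lemma hasDerivAt_realPolylog_two_comp {X : ℝ → ℝ} {x d : ℝ} (hX : HasDerivAt X (X x * d) x)
    (h0 : 0 < X x) (h1 : X x < 1) {l : ℝ} (hl : Real.log (1 - X x) = l) :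
    HasDerivAt (fun t => realPolylog 2 (X t)) (-l * d) x := by
  have habs : |X x| < 1 := by rwa [abs_of_pos h0]
  refine ((hasDerivAt_realPolylog 1 habs h0.ne').comp x hX).congr_deriv ?_
  rw [realPolylog_one_left habs, hl]
  field_simp

lemma hasDerivAt_realPolylog_three_comp {X : ℝ → ℝ} {x d : ℝ} (hX : HasDerivAt X (X x * d) x)
    (h0 : 0 < X x) (h1 : X x < 1) :
    HasDerivAt (fun t => realPolylog 3 (X t)) (realPolylog 2 (X x) * d) x := by
  refine ((hasDerivAt_realPolylog 2 (by rwa [abs_of_pos h0]) h0.ne').comp x hX).congr_deriv ?_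
  field_simp

/-- The five-term relation of the dilogarithm. -/
lemma realPolylog_two_five_term {y u w : ℝ} (hy : 0 < y) (hu : 0 < u) (huw : u < w) :
    realPolylog 2 (y * (w - u) / (w * (y + u))) - (Real.log w - Real.log (w - u)) *
      (Real.log u + Real.log (w + y) - Real.log w - Real.log (u + y)) =
    realPolylog 2 ((u + y) / (w + y)) + realPolylog 2 (y / (y + u)) - realPolylog 2 (y / (y + w))
      - realPolylog 2 (u / w) := by
  have hw : 0 < w := hu.trans huw
  have hr : 0 < w - u := sub_pos.2 huw
  -- The difference of the two sides as a function of `y`: it vanishes at 0 and has zero derivative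
  -- for positive `y`. At 0 some dilogarithm arguments vanish, so only continuity is used there.
  let G : ℝ → ℝ := fun y => realPolylog 2 (y * (w - u) / (w * (y + u))) -
    (Real.log w - Real.log (w - u)) *
      (Real.log u + Real.log (w + y) - Real.log w - Real.log (u + y)) -
    (realPolylog 2 ((u + y) / (w + y)) + realPolylog 2 (y / (y + u)) - realPolylog 2 (y / (y + w))
      - realPolylog 2 (u / w))
  have hG0 : G 0 = 0 := by
    simp only [G, zero_mul, zero_div, add_zero, realPolylog_zero_right]
    ring
  have hcont : ContinuousOn G (Set.Icc 0 y) := by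
    have hLi : ∀ X : ℝ → ℝ, ContinuousOn X (Set.Icc 0 y) →
        (∀ t ∈ Set.Icc 0 y, X t ∈ Set.Icc (0 : ℝ) 1) →
        ContinuousOn (fun t => realPolylog 2 (X t)) (Set.Icc 0 y) := fun X h1 h2 =>
      continuousOn_realPolylog_two.comp h1 h2
    have hne : ∀ c : ℝ, 0 < c → ∀ t ∈ Set.Icc 0 y, c + t ≠ 0 := fun c hc t ht =>
      (add_pos_of_pos_of_nonneg hc ht.1).ne'
    have hne' : ∀ c : ℝ, 0 < c → ∀ t ∈ Set.Icc 0 y, t + c ≠ 0 := fun c hc t ht =>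
      (add_pos_of_nonneg_of_pos ht.1 hc).ne'
    refine ((hLi _ ?_ ?_).sub (continuousOn_const.mul (((continuousOn_const.add ?_).sub
      continuousOn_const).sub ?_))).sub ((((hLi _ ?_ ?_).add (hLi _ ?_ ?_)).sub (hLi _ ?_ ?_)).sub
      continuousOn_const)
    · exact ContinuousOn.div (by fun_prop) (by fun_prop) fun t ht =>
        mul_ne_zero hw.ne' (hne' u hu t ht)
    · intro t ht
      have := ht.1
      refine ⟨by positivity, (div_le_one (by positivity)).2 ?_⟩
      nlinarith
    · exact ContinuousOn.log (by fun_prop) (hne w hw)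
    · exact ContinuousOn.log (by fun_prop) (hne u hu)
    · exact ContinuousOn.div (by fun_prop) (by fun_prop) (hne w hw)
    · intro t ht
      have := ht.1
      exact ⟨by positivity, (div_le_one (by positivity)).2 (by linarith)⟩
    · exact ContinuousOn.div (by fun_prop) (by fun_prop) (hne' u hu)
    · intro t ht
      have := ht.1
      exact ⟨by positivity, (div_le_one (by positivity)).2 (by linarith)⟩
    · exact ContinuousOn.div (by fun_prop) (by fun_prop) (hne' w hw)
    · intro t ht
      have := ht.1
      exact ⟨by positivity, (div_le_one (by positivity)).2 (by linarith)⟩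
  have hderiv : ∀ t ∈ Set.Ioo 0 y, HasDerivAt G 0 t := by
    rintro t ⟨ht, _⟩
    have hut : 0 < u + t := by positivity
    have hwt : 0 < w + t := by positivity
    have hp : HasDerivAt (fun t => Real.log (u + t)) (1 / (u + t)) t :=
      ((hasDerivAt_id t).const_add u).log hut.ne'
    have hq : HasDerivAt (fun t => Real.log (w + t)) (1 / (w + t)) t :=
      ((hasDerivAt_id t).const_add w).log hwt.ne'
    have h3 := hasDerivAt_realPolylog_two_comp (X := fun t => t * (w - u) / (w * (t + u)))
      (x := t) (d := 1 / t - 1 / (u + t))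
      (l := Real.log u + Real.log (w + t) - Real.log w - Real.log (u + t))
      ((((hasDerivAt_id t).mul_const (w - u)).div (((hasDerivAt_id t).add_const u).const_mul w)
        (by simp only [id]; positivity)).congr_deriv (by simp only [id]; field_simp; ring))
      (by positivity) ((div_lt_one (by positivity)).2 (by nlinarith))
      (by
        rw [← Real.log_mul hu.ne' hwt.ne', ← Real.log_div (by positivity) hw.ne',
          ← Real.log_div (by positivity) hut.ne']
        congr 1
        field_simp
        ring)
    have ha := hasDerivAt_realPolylog_two_comp (X := fun t => (u + t) / (w + t))
      (x := t) (d := 1 / (u + t) - 1 / (w + t)) (l := Real.log (w - u) - Real.log (w + t))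
      ((((hasDerivAt_id t).const_add u).div ((hasDerivAt_id t).const_add w)
        (by simp only [id]; positivity)).congr_deriv (by simp only [id]; field_simp))
      (by positivity) ((div_lt_one (by positivity)).2 (by linarith))
      (by
        rw [← Real.log_div hr.ne' hwt.ne']
        congr 1
        field_simp
        ring)
    have hb := fun (c : ℝ) (hc : 0 < c) =>
      hasDerivAt_realPolylog_two_comp (X := fun t => t / (t + c))
      (x := t) (d := 1 / t - 1 / (c + t)) (l := Real.log c - Real.log (c + t))
      (((hasDerivAt_id t).div ((hasDerivAt_id t).add_const c)
        (by simp only [id]; positivity)).congr_deriv (by simp only [id]; field_simp; ring))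
      (by positivity) ((div_lt_one (by positivity)).2 (by linarith))
      (by
        rw [← Real.log_div hc.ne' (by positivity)]
        congr 1
        field_simp
        ring)
    refine ((h3.sub (((((hq.const_add (Real.log u)).sub_const (Real.log w)).sub hp)).const_mul
      (Real.log w - Real.log (w - u)))).sub
      (((ha.add (hb u hu)).sub (hb w hw)).sub_const (realPolylog 2 (u / w)))).congr_deriv ?_
    ring
  obtain ⟨c, hc, hslope⟩ := exists_hasDerivAt_eq_slope G (fun _ => 0) hy hcont hderiv
  rw [hG0, sub_zero, sub_zero, eq_comm, div_eq_zero_iff] at hslope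
  exact sub_eq_zero.1 (hslope.resolve_right hy.ne')

/-- The closed form of the integral at real points, with logarithms of quotients expanded. -/
lemma integral_log_mul_log {y u w : ℝ} (hy : 0 < y) (hu : 0 < u) (huw : u < w) (hw1 : w < 1) :
    ∫ x in (0 : ℝ)..1, -(Real.log (1 - u * x) * Real.log (1 - w * x) * (y / (1 + y * x))) =
      Real.log (1 - u) * (Real.log u + Real.log (1 + y) - Real.log (u + y))
          * (Real.log y - Real.log (w + y))
        - Real.log (1 - w) * realPolylog 2 (y * (1 - u) / (y + u))
        - Real.log (1 - u) * (Real.log w + Real.log (1 + y) - Real.log (w + y))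
          * (Real.log y + Real.log (1 - w) - Real.log (w + y))
        - Real.log (1 - u) * realPolylog 2 (y * (1 - w) / (y + w))
        - (Real.log (u + y) - Real.log (w + y)) * (realPolylog 2 (y * (w - u) / (w * (y + u)))
            - (Real.log w - Real.log (w - u))
              * (Real.log u + Real.log (w + y) - Real.log w - Real.log (u + y)))
        + (Real.log (u + y) + Real.log (1 - w) - Real.log (w + y) - Real.log (1 - u))
          * (realPolylog 2 ((u + y) * (1 - w) / ((w + y) * (1 - u)))
            + realPolylog 2 (y * (1 - u) / (y + u)) - realPolylog 2 (y * (1 - w) / (y + w))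
            - realPolylog 2 (u * (1 - w) / (w * (1 - u))))
        + 1 / 2 * (Real.log w + Real.log (u + y) - Real.log u - Real.log (w + y))
          * ((Real.log (u + y) - Real.log y - Real.log (1 - u)) ^ 2
            - (Real.log y - Real.log (u + y)) ^ 2)
        + realPolylog 3 (y * (1 - w) / (y + w)) - realPolylog 3 (y / (y + w))
        + realPolylog 3 (y * (1 - u) / (y + u)) - realPolylog 3 (y / (y + u))
        + realPolylog 3 (u * (1 - w) / (w * (1 - u)))
        - realPolylog 3 ((u + y) * (1 - w) / ((w + y) * (1 - u)))
        - realPolylog 3 (u / w) + realPolylog 3 ((u + y) / (w + y)) := by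
  have hw : 0 < w := hu.trans huw
  have hr : 0 < w - u := sub_pos.2 huw
  set lu := Real.log u with hlu
  set ly := Real.log y with hly
  set lw := Real.log w with hlw
  set p := Real.log (u + y) with hp
  set q := Real.log (w + y) with hq
  set r := Real.log (w - u) with hr'
  -- The closed form at `(ux, -yx, wx)` with the common factors `x` cancelled, so that it also makes
  -- sense at `x = 0`.
  let R : ℝ → ℝ := fun x =>
      Real.log (1 - u * x) * (lu + Real.log (1 + y * x) - p) * (ly - q)
        - Real.log (1 - w * x) * realPolylog 2 (y * (1 - u * x) / (y + u))
        - Real.log (1 - u * x) * (lw + Real.log (1 + y * x) - q)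
          * (ly + Real.log (1 - w * x) - q)
        - Real.log (1 - u * x) * realPolylog 2 (y * (1 - w * x) / (y + w))
        - (p - q) * (realPolylog 2 (y * (w - u) / (w * (y + u))) - (lw - r) * (lu + q - lw - p))
        + (p + Real.log (1 - w * x) - q - Real.log (1 - u * x))
          * (realPolylog 2 ((u + y) * (1 - w * x) / ((w + y) * (1 - u * x)))
            + realPolylog 2 (y * (1 - u * x) / (y + u)) - realPolylog 2 (y * (1 - w * x) / (y + w))
            - realPolylog 2 (u * (1 - w * x) / (w * (1 - u * x))))
        + 1 / 2 * (lw + p - lu - q) * ((p - ly - Real.log (1 - u * x)) ^ 2 - (ly - p) ^ 2)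
        + realPolylog 3 (y * (1 - w * x) / (y + w)) - realPolylog 3 (y / (y + w))
        + realPolylog 3 (y * (1 - u * x) / (y + u)) - realPolylog 3 (y / (y + u))
        + realPolylog 3 (u * (1 - w * x) / (w * (1 - u * x)))
        - realPolylog 3 ((u + y) * (1 - w * x) / ((w + y) * (1 - u * x)))
        - realPolylog 3 (u / w) + realPolylog 3 ((u + y) / (w + y))
  have hpos : ∀ x ∈ Set.Icc (0 : ℝ) 1, 0 < 1 - u * x ∧ 0 < 1 + y * x ∧ 0 < 1 - w * x := by
    rintro x ⟨h0, h1⟩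
    exact ⟨by nlinarith, by positivity, by nlinarith⟩
  have hR : ∀ x ∈ Set.uIcc (0 : ℝ) 1, HasDerivAt R
      (-(Real.log (1 - u * x) * Real.log (1 - w * x) * (y / (1 + y * x)))) x := by
    intro x hx
    rw [Set.uIcc_of_le zero_le_one] at hx
    obtain ⟨hux, hyx, hwx⟩ := hpos x hx
    have hx0 := hx.1
    have hlin : ∀ c : ℝ, HasDerivAt (fun x : ℝ => 1 - c * x) (-c) x := fun c => by
      simpa using ((hasDerivAt_id x).const_mul c).const_sub 1
    have hA : HasDerivAt (fun x => Real.log (1 - u * x)) (-u / (1 - u * x)) x :=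
      (hlin u).log hux.ne'
    have hC : HasDerivAt (fun x => Real.log (1 - w * x)) (-w / (1 - w * x)) x :=
      (hlin w).log hwx.ne'
    have hB : HasDerivAt (fun x => Real.log (1 + y * x)) (y / (1 + y * x)) x := by
      refine HasDerivAt.log ?_ hyx.ne'
      simpa using ((hasDerivAt_id x).const_mul y).const_add 1
    have d1 : ∀ c : ℝ, 0 < 1 - c * x → HasDerivAt (fun x => y * (1 - c * x) / (y + c))
        (y * (1 - c * x) / (y + c) * (-c / (1 - c * x))) x := fun c hc =>
      (((hlin c).const_mul y).div_const (y + c)).congr_deriv (by field_simp)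
    have d2 : ∀ a b : ℝ, 0 < b → HasDerivAt (fun x => a * (1 - w * x) / (b * (1 - u * x)))
        (a * (1 - w * x) / (b * (1 - u * x)) * (-w / (1 - w * x) - -u / (1 - u * x))) x :=
      fun a b hb => (((hlin w).const_mul a).div ((hlin u).const_mul b)
        (by positivity)).congr_deriv (by field_simp)
    have b1 : ∀ c : ℝ, 0 < c → 0 < 1 - c * x → y * (1 - c * x) / (y + c) < 1 := fun c hc hcx =>
      (div_lt_one (by positivity)).2 (by nlinarith [mul_nonneg hc.le hx0])
    have l1 : ∀ c : ℝ, 0 < c → Real.log (1 - y * (1 - c * x) / (y + c)) =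
        Real.log c + Real.log (1 + y * x) - Real.log (c + y) := fun c hc => by
      rw [← Real.log_mul hc.ne' hyx.ne', ← Real.log_div (by positivity) (by positivity)]
      congr 1
      field_simp
      ring
    have b4 : (u + y) * (1 - w * x) / ((w + y) * (1 - u * x)) < 1 :=
      (div_lt_one (by positivity)).2 (by nlinarith [mul_pos hr hyx])
    have l4 : Real.log (1 - (u + y) * (1 - w * x) / ((w + y) * (1 - u * x))) =
        r + Real.log (1 + y * x) - q - Real.log (1 - u * x) := by
      rw [hr', hq, ← Real.log_mul hr.ne' hyx.ne', ← Real.log_div (by positivity) (by positivity),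
        ← Real.log_div (by positivity) (by positivity)]
      congr 1
      field_simp
      ring
    have b5 : u * (1 - w * x) / (w * (1 - u * x)) < 1 :=
      (div_lt_one (by positivity)).2 (by nlinarith)
    have l5 : Real.log (1 - u * (1 - w * x) / (w * (1 - u * x))) =
        r - lw - Real.log (1 - u * x) := by
      rw [hr', hlw, ← Real.log_div (by positivity) (by positivity),
        ← Real.log_div (by positivity) (by positivity)]
      congr 1
      field_simp
      ring
    have P1 := hasDerivAt_realPolylog_two_comp (d1 u hux) (by positivity) (b1 u hu hux) (l1 u hu)
    have P2 := hasDerivAt_realPolylog_two_comp (d1 w hwx) (by positivity) (b1 w hw hwx) (l1 w hw)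
    have P4 := hasDerivAt_realPolylog_two_comp (d2 (u + y) (w + y) (by positivity))
      (by positivity) b4 l4
    have P5 := hasDerivAt_realPolylog_two_comp (d2 u w hw) (by positivity) b5 l5
    have T1 := hasDerivAt_realPolylog_three_comp (d1 u hux) (by positivity) (b1 u hu hux)
    have T2 := hasDerivAt_realPolylog_three_comp (d1 w hwx) (by positivity) (b1 w hw hwx)
    have T4 := hasDerivAt_realPolylog_three_comp (d2 (u + y) (w + y) (by positivity))
      (by positivity) b4
    have T5 := hasDerivAt_realPolylog_three_comp (d2 u w hw) (by positivity) b5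
    rw [← hlu, ← hp] at P1
    rw [← hlw, ← hq] at P2
    refine (((((((((((((((((hA.mul ((hB.const_add lu).sub_const p)).mul_const (ly - q)).sub
      (hC.mul P1)).sub ((hA.mul ((hB.const_add lw).sub_const q)).mul
        ((hC.const_add ly).sub_const q))).sub (hA.mul P2)).sub_const _).add
      ((((hC.const_add p).sub_const q).sub hA).mul (((P4.add P1).sub P2).sub P5))).add
      ((((hA.const_sub (p - ly)).pow 2).sub_const ((ly - p) ^ 2)).const_mul
        (1 / 2 * (lw + p - lu - q)))).add T2).sub_const _).add T1).sub_const _).add T5).sub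
      T4).sub_const _).add_const _)).congr_deriv ?_
    simp only [Pi.sub_apply, Pi.add_apply, Pi.mul_apply]
    -- With the three logarithmic derivatives as indeterminates, the claim is a polynomial identity:
    -- the dilogarithms cancel against the derivatives of the `Li_3` terms.
    generalize -u / (1 - u * x) = a'
    generalize -w / (1 - w * x) = c'
    generalize y / (1 + y * x) = b'
    ring
  have hint : IntervalIntegrable
      (fun x => -(Real.log (1 - u * x) * Real.log (1 - w * x) * (y / (1 + y * x))))
      MeasureTheory.volume 0 1 := by
    refine ContinuousOn.intervalIntegrable ?_
    rw [Set.uIcc_of_le zero_le_one]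
    refine (ContinuousOn.mul (ContinuousOn.mul ?_ ?_) ?_).neg
    · exact ContinuousOn.log (by fun_prop) fun x hx => (hpos x hx).1.ne'
    · exact ContinuousOn.log (by fun_prop) fun x hx => (hpos x hx).2.2.ne'
    · exact ContinuousOn.div (by fun_prop) (by fun_prop) fun x hx => (hpos x hx).2.1.ne'
  -- At `x = 0` the logarithms of `1 - ux` and `1 - wx` vanish, the two squares agree and the `Li_3`
  -- terms pair off. What is left is `p - q` times the five-term relation.
  have hR0 : R 0 = 0 := by
    have := realPolylog_two_five_term hy hu huw
    rw [← hlu, ← hlw, ← hp, ← hq, ← hr'] at this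
    simp only [R, mul_zero, sub_zero, add_zero, Real.log_one, mul_one, zero_mul]
    rw [this]
    ring
  rw [intervalIntegral.integral_eq_sub_of_hasDerivAt hR hint, hR0, sub_zero]
  simp only [R, mul_one]

/-! ### From the real formula to the complex expression. -/

/-- The closed form of `F(1; u, v, w)`, with principal logarithms and polylogarithm series. -/
noncomputable def hzFormula (q : ℂ × ℂ × ℂ) : ℂ :=
  Complex.log (1 - q.1) * Complex.log (q.1 * (1 - q.2.1) / (q.1 - q.2.1))
      * Complex.log (q.2.1 / (q.2.1 - q.2.2))
    - Complex.log (1 - q.2.2) * polylogSeries 2 (q.2.1 * (1 - q.1) / (q.2.1 - q.1))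
    - Complex.log (1 - q.1) * Complex.log (q.2.2 * (1 - q.2.1) / (q.2.2 - q.2.1))
        * Complex.log (q.2.1 * (1 - q.2.2) / (q.2.1 - q.2.2))
    - Complex.log (1 - q.1) * polylogSeries 2 (q.2.1 * (1 - q.2.2) / (q.2.1 - q.2.2))
    - Complex.log ((q.2.1 - q.1) / (q.2.1 - q.2.2))
        * (polylogSeries 2 (q.2.1 * (q.2.2 - q.1) / (q.2.2 * (q.2.1 - q.1)))
          - Complex.log (q.2.2 / (q.2.2 - q.1))
            * Complex.log (q.1 * (q.2.2 - q.2.1) / (q.2.2 * (q.1 - q.2.1))))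
    + Complex.log ((q.2.1 - q.1) * (q.2.2 - 1) / ((q.2.1 - q.2.2) * (q.1 - 1)))
        * (polylogSeries 2 ((q.2.1 - q.1) * (q.2.2 - 1) / ((q.2.1 - q.2.2) * (q.1 - 1)))
          + polylogSeries 2 (q.2.1 * (1 - q.1) / (q.2.1 - q.1))
          - polylogSeries 2 (q.2.1 * (1 - q.2.2) / (q.2.1 - q.2.2))
          - polylogSeries 2 (q.1 * (1 - q.2.2) / (q.2.2 * (1 - q.1))))
    + 1 / 2 * Complex.log (q.2.2 * (q.1 - q.2.1) / (q.1 * (q.2.2 - q.2.1)))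
        * (Complex.log ((q.1 - q.2.1) / (q.2.1 * (q.1 - 1))) ^ 2
          - Complex.log (q.2.1 / (q.2.1 - q.1)) ^ 2)
    + polylogSeries 3 (q.2.1 * (1 - q.2.2) / (q.2.1 - q.2.2))
    - polylogSeries 3 (q.2.1 / (q.2.1 - q.2.2))
    + polylogSeries 3 (q.2.1 * (1 - q.1) / (q.2.1 - q.1))
    - polylogSeries 3 (q.2.1 / (q.2.1 - q.1))
    + polylogSeries 3 (q.1 * (1 - q.2.2) / (q.2.2 * (1 - q.1)))
    - polylogSeries 3 ((q.2.1 - q.1) * (q.2.2 - 1) / ((q.2.1 - q.2.2) * (q.1 - 1)))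
    - polylogSeries 3 (q.1 / q.2.2) + polylogSeries 3 ((q.2.1 - q.1) / (q.2.1 - q.2.2))

/-- All arguments are positive reals here, so principal logarithms of quotients split. The
conditions are open, which gives a full real neighbourhood of the start even when `b = -1`. -/
lemma hzF_eq_hzFormula_of_real {a b c : ℝ} (hb : b < 0) (ha : 0 < a) (hac : a < c) (hc1 : c < 1) :
    hzF 1 a b c = hzFormula ((a : ℂ), (b : ℂ), (c : ℂ)) := by
  obtain ⟨y, rfl⟩ : ∃ y : ℝ, b = -y := ⟨-b, (neg_neg b).symm⟩
  have hy : 0 < y := by linarith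
  have hc : 0 < c := ha.trans hac
  have hca : 0 < c - a := sub_pos.2 hac
  have ha1 : 0 < 1 - a := by linarith
  have hc1' : 0 < 1 - c := by linarith
  have hint : hzF 1 a (-y : ℝ) c = ((∫ x in (0 : ℝ)..1,
      -(Real.log (1 - a * x) * Real.log (1 - c * x) * (y / (1 + y * x))) : ℝ) : ℂ) := by
    rw [hzF, ← intervalIntegral.integral_ofReal]
    refine intervalIntegral.integral_congr fun t ht => ?_
    rw [Set.uIcc_of_le zero_le_one] at ht
    have h0 := ht.1
    have hat : 0 < 1 - a * t := by nlinarith [ht.2]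
    have hct : 0 < 1 - c * t := by nlinarith [ht.2]
    have hyt : 0 < 1 + y * t := by positivity
    have h : (-y)⁻¹ - t = -(y / (1 + y * t))⁻¹ := by field_simp; ring
    have h' : ((-y : ℝ) : ℂ)⁻¹ - (t : ℂ) = ((-(y / (1 + y * t))⁻¹ : ℝ) : ℂ) := by
      rw [← h]
      push_cast
      ring
    simp only [hzIntegrand, Complex.cpow_one, h']
    rw [show 1 - (a : ℂ) * t = ((1 - a * t : ℝ) : ℂ) by push_cast; ring,
      show 1 - (c : ℂ) * t = ((1 - c * t : ℝ) : ℂ) by push_cast; ring,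
      ← Complex.ofReal_log hat.le, ← Complex.ofReal_log hct.le, ← Complex.ofReal_mul,
      ← Complex.ofReal_div, div_neg, div_inv_eq_mul]
  have hlog : ∀ {z : ℂ} {r l : ℝ}, z = r → 0 < r → Real.log r = l → Complex.log z = l := by
    rintro z r l rfl hr rfl
    exact (Complex.ofReal_log hr.le).symm
  have hLi : ∀ (n : ℕ) {z : ℂ} {r : ℝ}, z = r → polylogSeries n z = realPolylog n r := by
    rintro n z r rfl
    exact polylogSeries_ofReal n r
  have x1 : ((-y : ℝ) : ℂ) * (1 - a) / ((-y : ℝ) - a) = ((y * (1 - a) / (y + a) : ℝ) : ℂ) := by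
    rw [← neg_div_neg_eq]; push_cast; congr 1 <;> ring
  have x2 : ((-y : ℝ) : ℂ) * (1 - c) / ((-y : ℝ) - c) = ((y * (1 - c) / (y + c) : ℝ) : ℂ) := by
    rw [← neg_div_neg_eq]; push_cast; congr 1 <;> ring
  have x3 : ((-y : ℝ) : ℂ) * (c - a) / (c * ((-y : ℝ) - a)) =
      ((y * (c - a) / (c * (y + a)) : ℝ) : ℂ) := by
    rw [← neg_div_neg_eq]; push_cast; congr 1 <;> ring
  have x4 : (((-y : ℝ) : ℂ) - a) * (c - 1) / (((-y : ℝ) - c) * (a - 1)) =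
      (((a + y) * (1 - c) / ((c + y) * (1 - a)) : ℝ) : ℂ) := by
    push_cast; congr 1 <;> ring
  have x5 : (a : ℂ) * (1 - c) / (c * (1 - a)) = ((a * (1 - c) / (c * (1 - a)) : ℝ) : ℂ) := by
    push_cast; rfl
  have x6 : ((-y : ℝ) : ℂ) / ((-y : ℝ) - c) = ((y / (y + c) : ℝ) : ℂ) := by
    rw [← neg_div_neg_eq]; push_cast; congr 1 <;> ring
  have x7 : ((-y : ℝ) : ℂ) / ((-y : ℝ) - a) = ((y / (y + a) : ℝ) : ℂ) := by
    rw [← neg_div_neg_eq]; push_cast; congr 1 <;> ring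
  have x8 : (a : ℂ) / c = ((a / c : ℝ) : ℂ) := by push_cast; rfl
  have x9 : (((-y : ℝ) : ℂ) - a) / ((-y : ℝ) - c) = (((a + y) / (c + y) : ℝ) : ℂ) := by
    rw [← neg_div_neg_eq]; push_cast; congr 1 <;> ring
  have hya : 0 < a + y := by positivity
  have hyc : 0 < c + y := by positivity
  have hy1 : 0 < 1 + y := by positivity
  have m0 : ∀ {r : ℝ}, 0 < r → r ≠ 0 := fun h => h.ne'
  have a1 : Complex.log (1 - a) = (Real.log (1 - a) : ℝ) :=
    hlog (r := 1 - a) (by push_cast; rfl) ha1 rfl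
  have c1 : Complex.log (1 - c) = (Real.log (1 - c) : ℝ) :=
    hlog (r := 1 - c) (by push_cast; rfl) hc1' rfl
  have g1 : Complex.log ((a : ℂ) * (1 - (-y : ℝ)) / (a - (-y : ℝ))) =
      (Real.log a + Real.log (1 + y) - Real.log (a + y) : ℝ) :=
    hlog (r := a * (1 + y) / (a + y)) (by push_cast; congr 1 <;> ring) (by positivity)
      (by rw [Real.log_div (by positivity) (by positivity), Real.log_mul (m0 ha) (m0 hy1)])
  have g2 : Complex.log (((-y : ℝ) : ℂ) / ((-y : ℝ) - c)) = (Real.log y - Real.log (c + y) : ℝ) :=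
    hlog x6 (by positivity) (by rw [Real.log_div (by positivity) (by positivity), add_comm y c])
  have g3 : Complex.log ((c : ℂ) * (1 - (-y : ℝ)) / (c - (-y : ℝ))) =
      (Real.log c + Real.log (1 + y) - Real.log (c + y) : ℝ) :=
    hlog (r := c * (1 + y) / (c + y)) (by push_cast; congr 1 <;> ring) (by positivity)
      (by rw [Real.log_div (by positivity) (by positivity), Real.log_mul (m0 hc) (m0 hy1)])
  have g4 : Complex.log (((-y : ℝ) : ℂ) * (1 - c) / ((-y : ℝ) - c)) =
      (Real.log y + Real.log (1 - c) - Real.log (c + y) : ℝ) :=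
    hlog x2 (by positivity) (by rw [Real.log_div (by positivity) (by positivity),
      Real.log_mul (m0 hy) (m0 hc1'), add_comm y c])
  have g5 : Complex.log ((((-y : ℝ) : ℂ) - a) / ((-y : ℝ) - c)) =
      (Real.log (a + y) - Real.log (c + y) : ℝ) :=
    hlog x9 (by positivity) (by rw [Real.log_div (by positivity) (by positivity)])
  have g6 : Complex.log ((c : ℂ) / (c - a)) = (Real.log c - Real.log (c - a) : ℝ) :=
    hlog (r := c / (c - a)) (by push_cast; rfl) (by positivity)
      (by rw [Real.log_div (by positivity) (by positivity)])
  have g7 : Complex.log ((a : ℂ) * (c - (-y : ℝ)) / (c * (a - (-y : ℝ)))) =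
      (Real.log a + Real.log (c + y) - Real.log c - Real.log (a + y) : ℝ) :=
    hlog (r := a * (c + y) / (c * (a + y))) (by push_cast; congr 1 <;> ring) (by positivity)
      (by
        rw [Real.log_div (by positivity) (by positivity), Real.log_mul (m0 ha) (m0 hyc),
          Real.log_mul (m0 hc) (m0 hya)]
        ring)
  have g8 : Complex.log ((((-y : ℝ) : ℂ) - a) * (c - 1) / (((-y : ℝ) - c) * (a - 1))) =
      (Real.log (a + y) + Real.log (1 - c) - Real.log (c + y) - Real.log (1 - a) : ℝ) :=
    hlog x4 (by positivity)
      (by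
        rw [Real.log_div (by positivity) (by positivity), Real.log_mul (m0 hya) (m0 hc1'),
          Real.log_mul (m0 hyc) (m0 ha1)]
        ring)
  have g9 : Complex.log ((c : ℂ) * (a - (-y : ℝ)) / (a * (c - (-y : ℝ)))) =
      (Real.log c + Real.log (a + y) - Real.log a - Real.log (c + y) : ℝ) :=
    hlog (r := c * (a + y) / (a * (c + y))) (by push_cast; congr 1 <;> ring) (by positivity)
      (by
        rw [Real.log_div (by positivity) (by positivity), Real.log_mul (m0 hc) (m0 hya),
          Real.log_mul (m0 ha) (m0 hyc)]
        ring)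
  have g10 : Complex.log (((a : ℂ) - (-y : ℝ)) / ((-y : ℝ) * (a - 1))) =
      (Real.log (a + y) - Real.log y - Real.log (1 - a) : ℝ) :=
    hlog (r := (a + y) / (y * (1 - a))) (by push_cast; congr 1 <;> ring) (by positivity)
      (by
        rw [Real.log_div (by positivity) (by positivity), Real.log_mul (m0 hy) (m0 ha1)]
        ring)
  have g11 : Complex.log (((-y : ℝ) : ℂ) / ((-y : ℝ) - a)) = (Real.log y - Real.log (a + y) : ℝ) :=
    hlog x7 (by positivity) (by rw [Real.log_div (by positivity) (by positivity), add_comm y a])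
  rw [hint, integral_log_mul_log hy ha hac hc1, hzFormula]
  simp only [a1, c1, g1, g2, g3, g4, g5, g6, g7, g8, g9, g10, g11, hLi 2 x1, hLi 2 x2, hLi 2 x3,
    hLi 2 x4, hLi 2 x5, hLi 3 x1, hLi 3 x2, hLi 3 x4, hLi 3 x5, hLi 3 x6, hLi 3 x7, hLi 3 x8,
    hLi 3 x9]
  push_cast
  rfl

/-! ### Continuation of the individual terms and conclusion. -/

section Terms

variable {p : I → ℂ × ℂ × ℂ} {N D : ℂ × ℂ × ℂ → ℂ} {c : I → ℂ}

lemma eventually_differentiableAt_div (hN : Differentiable ℂ N) (hD : Differentiable ℂ D)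
    (hD0 : ∀ s, D (p s) ≠ 0) (s : I) :
    ∀ᶠ q in 𝓝 (p s), DifferentiableAt ℂ (fun q => N q / D q) q := by
  filter_upwards [hD.continuous.continuousAt.eventually_ne (hD0 s)] with q hq
  simp only [div_eq_mul_inv]
  exact (hN q).mul ((hD q).inv hq)

lemma continuableAlong_log_and_hasContinuedValue (hp : Continuous p)
    (hc : ∀ s, c s = N (p s) / D (p s)) (hN : Differentiable ℂ N) (hD : Differentiable ℂ D)
    (hN0 : ∀ s, N (p s) ≠ 0) (hD0 : ∀ s, D (p s) ≠ 0) {r : ℝ} (hr : 0 < r) (h0 : N (p 0) / D (p 0) = r) :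
    ContinuableAlong Complex.log c ∧
      HasContinuedValue p (fun q => Complex.log (N q / D q)) (logAlong c) := by
  have hcc : Continuous c := by
    rw [funext hc]
    exact (hN.continuous.comp hp).div (hD.continuous.comp hp) hD0
  have h : ContinuableAlong Complex.log c := by
    refine continuableAlong_log hcc (fun s => ?_) ?_
    · rw [hc]
      exact div_ne_zero (hN0 s) (hD0 s)
    · rw [hc, h0]
      exact Complex.ofReal_mem_slitPlane.2 hr
  exact ⟨h, hasContinuedValue_continuedValue hc h (eventually_differentiableAt_div hN hD hD0)⟩

lemma continuableAlong_polylogSeries_and_hasContinuedValue (hp : Continuous p)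
    (hc : ∀ s, c s = N (p s) / D (p s)) (hN : Differentiable ℂ N) (hD : Differentiable ℂ D)
    (hN0 : ∀ s, N (p s) ≠ 0) (hD0 : ∀ s, D (p s) ≠ 0) (hND : ∀ s, D (p s) - N (p s) ≠ 0)
    {r : ℝ} (hr : 0 < r) (hr1 : r < 1) (h0 : N (p 0) / D (p 0) = r) (n : ℕ) :
    ContinuableAlong (polylogSeries n) c ∧
      HasContinuedValue p (fun q => polylogSeries n (N q / D q)) (LiAlong n c) := by
  have hcc : Continuous c := by
    rw [funext hc]
    exact (hN.continuous.comp hp).div (hD.continuous.comp hp) hD0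
  have h : ContinuableAlong (polylogSeries n) c := by
    refine continuableAlong_polylogSeries n hcc (fun s => ?_) (fun s => ?_) ?_
    · rw [hc]
      exact div_ne_zero (hN0 s) (hD0 s)
    · rw [hc]
      intro h1
      rw [div_eq_one_iff_eq (hD0 s)] at h1
      exact hND s (sub_eq_zero.2 h1.symm)
    · rwa [hc, h0, Complex.norm_real, Real.norm_of_nonneg hr.le]
  exact ⟨h, hasContinuedValue_continuedValue hc h (eventually_differentiableAt_div hN hD hD0)⟩

end Terms

theorem mainTheorem1 (u₁ v₁ w₁ : ℂ)
    (hu : u₁ ∈ discPrime) (hv : v₁ ∈ discPrime) (hw : w₁ ∈ discPrime)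
    (huv : u₁ ≠ v₁) (hvw : v₁ ≠ w₁) (huw : u₁ ≠ w₁) :
    -- the integral converges
    IntervalIntegrable (hzIntegrand 1 u₁ v₁ w₁) MeasureTheory.volume 0 1 ∧
    -- the triple can be reached by an admissible path
    (∃ u v w : unitInterval → ℂ, IsAdmissible u v w ∧ u 1 = u₁ ∧ v 1 = v₁ ∧ w 1 = w₁) ∧
    -- and along every such path all the terms can be continued and the formula holds
    ∀ u v w : unitInterval → ℂ, IsAdmissible u v w → u 1 = u₁ → v 1 = v₁ → w 1 = w₁ →
      (∀ c ∈ [u * (1 - v) / (u - v), v / (v - w), w * (1 - v) / (w - v), v * (1 - w) / (v - w),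
          (v - u) / (v - w), w / (w - u), u * (w - v) / (w * (u - v)),
          (v - u) * (w - 1) / ((v - w) * (u - 1)), w * (u - v) / (u * (w - v)),
          (u - v) / (v * (u - 1)), v / (v - u)],
        ContinuableAlong Complex.log c) ∧
      (∀ c ∈ [v * (1 - u) / (v - u), v * (1 - w) / (v - w), v * (w - u) / (w * (v - u)),
          (v - u) * (w - 1) / ((v - w) * (u - 1)), u * (1 - w) / (w * (1 - u))],
        ContinuableAlong (polylogSeries 2) c) ∧
      (∀ c ∈ [v * (1 - w) / (v - w), v / (v - w), v * (1 - u) / (v - u), v / (v - u),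
          u * (1 - w) / (w * (1 - u)), (v - u) * (w - 1) / ((v - w) * (u - 1)), u / w,
          (v - u) / (v - w)],
        ContinuableAlong (polylogSeries 3) c) ∧
      hzF 1 u₁ v₁ w₁ =
        Complex.log (1 - u₁) * logAlong (u * (1 - v) / (u - v)) * logAlong (v / (v - w))
        - Complex.log (1 - w₁) * LiAlong 2 (v * (1 - u) / (v - u))
        - Complex.log (1 - u₁) * logAlong (w * (1 - v) / (w - v))
            * logAlong (v * (1 - w) / (v - w))
        - Complex.log (1 - u₁) * LiAlong 2 (v * (1 - w) / (v - w))
        - logAlong ((v - u) / (v - w))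
            * (LiAlong 2 (v * (w - u) / (w * (v - u)))
              - logAlong (w / (w - u)) * logAlong (u * (w - v) / (w * (u - v))))
        + logAlong ((v - u) * (w - 1) / ((v - w) * (u - 1)))
            * (LiAlong 2 ((v - u) * (w - 1) / ((v - w) * (u - 1)))
              + LiAlong 2 (v * (1 - u) / (v - u))
              - LiAlong 2 (v * (1 - w) / (v - w))
              - LiAlong 2 (u * (1 - w) / (w * (1 - u))))
        + 1 / 2 * logAlong (w * (u - v) / (u * (w - v)))
            * (logAlong ((u - v) / (v * (u - 1))) ^ 2 - logAlong (v / (v - u)) ^ 2)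
        + LiAlong 3 (v * (1 - w) / (v - w)) - LiAlong 3 (v / (v - w))
        + LiAlong 3 (v * (1 - u) / (v - u)) - LiAlong 3 (v / (v - u))
        + LiAlong 3 (u * (1 - w) / (w * (1 - u)))
        - LiAlong 3 ((v - u) * (w - 1) / ((v - w) * (u - 1)))
        - LiAlong 3 (u / w) + LiAlong 3 ((v - u) / (v - w)) := by 
  have hmem : ((u₁, v₁, w₁) : ℂ × ℂ × ℂ) ∈ hzDomain :=
    ⟨one_sub_mem_slitPlane hu, one_sub_mem_slitPlane hv, one_sub_mem_slitPlane hw, hv.1⟩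
  refine ⟨intervalIntegrable_hzIntegrand (q := (u₁, v₁, w₁)) hmem, exists_isAdmissible hu hv hw huv hvw huw, ?_⟩
  intro u v w had hu1 hv1 hw1
  subst hu1 hv1 hw1
  obtain ⟨a, b, c, -, hb, ha, hac, hc1, hu0, hv0, hw0⟩ := had.start
  let p : I → ℂ × ℂ × ℂ := fun s => (u s, v s, w s)
  have hp : Continuous p := had.continuous_u.prodMk (had.continuous_v.prodMk had.continuous_w)
  have hp0 : p 0 = ((a : ℂ), (b : ℂ), (c : ℂ)) := by simp only [p, hu0, hv0, hw0]
  have hdom : ∀ s, ∀ᶠ q in 𝓝 (p s), q ∈ hzDomain := fun s =>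
    isOpen_hzDomain.mem_nhds ⟨one_sub_mem_slitPlane (had.mem_u s),
      one_sub_mem_slitPlane (had.mem_v s), one_sub_mem_slitPlane (had.mem_w s), (had.mem_v s).1⟩
  have u0 : ∀ s, u s ≠ 0 := fun s => (had.mem_u s).1
  have v0 : ∀ s, v s ≠ 0 := fun s => (had.mem_v s).1
  have w0 : ∀ s, w s ≠ 0 := fun s => (had.mem_w s).1
  have u1 : ∀ s, 1 - u s ≠ 0 := fun s => sub_ne_zero.2 (had.mem_u s).2.2.symm
  have u1' : ∀ s, u s - 1 ≠ 0 := fun s => sub_ne_zero.2 (had.mem_u s).2.2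
  have v1 : ∀ s, 1 - v s ≠ 0 := fun s => sub_ne_zero.2 (had.mem_v s).2.2.symm
  have w1 : ∀ s, 1 - w s ≠ 0 := fun s => sub_ne_zero.2 (had.mem_w s).2.2.symm
  have w1' : ∀ s, w s - 1 ≠ 0 := fun s => sub_ne_zero.2 (had.mem_w s).2.2
  have uv : ∀ s, u s - v s ≠ 0 := fun s => sub_ne_zero.2 (had.u_ne_v s)
  have vu : ∀ s, v s - u s ≠ 0 := fun s => sub_ne_zero.2 (had.u_ne_v s).symm
  have vw : ∀ s, v s - w s ≠ 0 := fun s => sub_ne_zero.2 (had.v_ne_w s)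
  have wv : ∀ s, w s - v s ≠ 0 := fun s => sub_ne_zero.2 (had.v_ne_w s).symm
  have wu : ∀ s, w s - u s ≠ 0 := fun s => sub_ne_zero.2 (had.u_ne_w s).symm
  obtain ⟨y, rfl⟩ : ∃ y : ℝ, b = -y := ⟨-b, (neg_neg b).symm⟩
  have hy : 0 < y := by linarith
  have hc : 0 < c := ha.trans hac
  have hca : 0 < c - a := sub_pos.2 hac
  have ha1 : 0 < 1 - a := by linarith
  have hc1' : 0 < 1 - c := by linarith
  have l1 := continuableAlong_log_and_hasContinuedValue (c := u * (1 - v) / (u - v)) hp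
    (N := fun q => q.1 * (1 - q.2.1)) (D := fun q => q.1 - q.2.1)
    (fun _ => rfl) (by fun_prop) (by fun_prop) (fun s => mul_ne_zero (u0 s) (v1 s)) (fun s => uv s)
    (r := a * (1 + y) / (a + y)) (by positivity) (by
      simp only [hp0]
      push_cast
      congr 1 <;> ring)
  have l2 := continuableAlong_log_and_hasContinuedValue (c := v / (v - w)) hp
    (N := fun q => q.2.1) (D := fun q => q.2.1 - q.2.2)
    (fun _ => rfl) (by fun_prop) (by fun_prop) (fun s => v0 s) (fun s => vw s)
    (r := y / (y + c)) (by positivity) (by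
      simp only [hp0]
      rw [← neg_div_neg_eq]
      push_cast
      congr 1 <;> ring)
  have l3 := continuableAlong_log_and_hasContinuedValue (c := w * (1 - v) / (w - v)) hp
    (N := fun q => q.2.2 * (1 - q.2.1)) (D := fun q => q.2.2 - q.2.1)
    (fun _ => rfl) (by fun_prop) (by fun_prop) (fun s => mul_ne_zero (w0 s) (v1 s)) (fun s => wv s)
    (r := c * (1 + y) / (c + y)) (by positivity) (by
      simp only [hp0]
      push_cast
      congr 1 <;> ring)
  have l4 := continuableAlong_log_and_hasContinuedValue (c := v * (1 - w) / (v - w)) hp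
    (N := fun q => q.2.1 * (1 - q.2.2)) (D := fun q => q.2.1 - q.2.2)
    (fun _ => rfl) (by fun_prop) (by fun_prop) (fun s => mul_ne_zero (v0 s) (w1 s)) (fun s => vw s)
    (r := y * (1 - c) / (y + c)) (by positivity) (by
      simp only [hp0]
      rw [← neg_div_neg_eq]
      push_cast
      congr 1 <;> ring)
  have l5 := continuableAlong_log_and_hasContinuedValue (c := (v - u) / (v - w)) hp
    (N := fun q => q.2.1 - q.1) (D := fun q => q.2.1 - q.2.2)
    (fun _ => rfl) (by fun_prop) (by fun_prop) (fun s => vu s) (fun s => vw s)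
    (r := (a + y) / (c + y)) (by positivity) (by
      simp only [hp0]
      rw [← neg_div_neg_eq]
      push_cast
      congr 1 <;> ring)
  have l6 := continuableAlong_log_and_hasContinuedValue (c := w / (w - u)) hp
    (N := fun q => q.2.2) (D := fun q => q.2.2 - q.1)
    (fun _ => rfl) (by fun_prop) (by fun_prop) (fun s => w0 s) (fun s => wu s)
    (r := c / (c - a)) (by positivity) (by
      simp only [hp0]
      push_cast
      congr 1)
  have l7 := continuableAlong_log_and_hasContinuedValue (c := u * (w - v) / (w * (u - v))) hp
    (N := fun q => q.1 * (q.2.2 - q.2.1)) (D := fun q => q.2.2 * (q.1 - q.2.1))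
    (fun _ => rfl) (by fun_prop) (by fun_prop) (fun s => mul_ne_zero (u0 s) (wv s)) (fun s => mul_ne_zero (w0 s) (uv s))
    (r := a * (c + y) / (c * (a + y))) (by positivity) (by
      simp only [hp0]
      push_cast
      congr 1 <;> ring)
  have l8 := continuableAlong_log_and_hasContinuedValue (c := (v - u) * (w - 1) / ((v - w) * (u - 1))) hp
    (N := fun q => (q.2.1 - q.1) * (q.2.2 - 1)) (D := fun q => (q.2.1 - q.2.2) * (q.1 - 1))
    (fun _ => rfl) (by fun_prop) (by fun_prop) (fun s => mul_ne_zero (vu s) (w1' s)) (fun s => mul_ne_zero (vw s) (u1' s))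
    (r := (a + y) * (1 - c) / ((c + y) * (1 - a))) (by positivity) (by
      simp only [hp0]
      push_cast
      congr 1 <;> ring)
  have l9 := continuableAlong_log_and_hasContinuedValue (c := w * (u - v) / (u * (w - v))) hp
    (N := fun q => q.2.2 * (q.1 - q.2.1)) (D := fun q => q.1 * (q.2.2 - q.2.1))
    (fun _ => rfl) (by fun_prop) (by fun_prop) (fun s => mul_ne_zero (w0 s) (uv s)) (fun s => mul_ne_zero (u0 s) (wv s))
    (r := c * (a + y) / (a * (c + y))) (by positivity) (by
      simp only [hp0]
      push_cast
      congr 1 <;> ring)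
  have l10 := continuableAlong_log_and_hasContinuedValue (c := (u - v) / (v * (u - 1))) hp
    (N := fun q => q.1 - q.2.1) (D := fun q => q.2.1 * (q.1 - 1))
    (fun _ => rfl) (by fun_prop) (by fun_prop) (fun s => uv s) (fun s => mul_ne_zero (v0 s) (u1' s))
    (r := (a + y) / (y * (1 - a))) (by positivity) (by
      simp only [hp0]
      push_cast
      congr 1 <;> ring)
  have l11 := continuableAlong_log_and_hasContinuedValue (c := v / (v - u)) hp
    (N := fun q => q.2.1) (D := fun q => q.2.1 - q.1)
    (fun _ => rfl) (by fun_prop) (by fun_prop) (fun s => v0 s) (fun s => vu s)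
    (r := y / (y + a)) (by positivity) (by
      simp only [hp0]
      rw [← neg_div_neg_eq]
      push_cast
      congr 1 <;> ring)
  have x1 := continuableAlong_polylogSeries_and_hasContinuedValue (c := v * (1 - u) / (v - u)) hp
    (N := fun q => q.2.1 * (1 - q.1)) (D := fun q => q.2.1 - q.1)
    (fun _ => rfl) (by fun_prop) (by fun_prop) (fun s => mul_ne_zero (v0 s) (u1 s)) (fun s => vu s)
    -- Denominator minus numerator factors as `-u (1 - v)`, so the argument never equals 1. The
    -- other polylogarithm arguments have similar factorizations.
    (fun s => by convert neg_ne_zero.2 (mul_ne_zero (u0 s) (v1 s)) using 1; simp only [p]; ring)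
    (r := y * (1 - a) / (y + a)) (by positivity) ((div_lt_one (by positivity)).2 (by nlinarith)) (by
      simp only [hp0]
      rw [← neg_div_neg_eq]
      push_cast
      congr 1 <;> ring)
  have x2 := continuableAlong_polylogSeries_and_hasContinuedValue (c := v * (1 - w) / (v - w)) hp
    (N := fun q => q.2.1 * (1 - q.2.2)) (D := fun q => q.2.1 - q.2.2)
    (fun _ => rfl) (by fun_prop) (by fun_prop) (fun s => mul_ne_zero (v0 s) (w1 s)) (fun s => vw s)
    (fun s => by convert neg_ne_zero.2 (mul_ne_zero (w0 s) (v1 s)) using 1; simp only [p]; ring)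
    (r := y * (1 - c) / (y + c)) (by positivity) ((div_lt_one (by positivity)).2 (by nlinarith)) (by
      simp only [hp0]
      rw [← neg_div_neg_eq]
      push_cast
      congr 1 <;> ring)
  have x3 := continuableAlong_polylogSeries_and_hasContinuedValue (c := v * (w - u) / (w * (v - u))) hp
    (N := fun q => q.2.1 * (q.2.2 - q.1)) (D := fun q => q.2.2 * (q.2.1 - q.1))
    (fun _ => rfl) (by fun_prop) (by fun_prop) (fun s => mul_ne_zero (v0 s) (wu s)) (fun s => mul_ne_zero (w0 s) (vu s))
    (fun s => by convert mul_ne_zero (u0 s) (vw s) using 1; simp only [p]; ring)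
    (r := y * (c - a) / (c * (y + a))) (by positivity) ((div_lt_one (by positivity)).2 (by nlinarith)) (by
      simp only [hp0]
      rw [← neg_div_neg_eq]
      push_cast
      congr 1 <;> ring)
  have x4 := continuableAlong_polylogSeries_and_hasContinuedValue (c := (v - u) * (w - 1) / ((v - w) * (u - 1))) hp
    (N := fun q => (q.2.1 - q.1) * (q.2.2 - 1)) (D := fun q => (q.2.1 - q.2.2) * (q.1 - 1))
    (fun _ => rfl) (by fun_prop) (by fun_prop) (fun s => mul_ne_zero (vu s) (w1' s)) (fun s => mul_ne_zero (vw s) (u1' s))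
    (fun s => by convert mul_ne_zero (wu s) (v1 s) using 1; simp only [p]; ring)
    (r := (a + y) * (1 - c) / ((c + y) * (1 - a))) (by positivity) ((div_lt_one (by positivity)).2 (by nlinarith)) (by
      simp only [hp0]
      push_cast
      congr 1 <;> ring)
  have x5 := continuableAlong_polylogSeries_and_hasContinuedValue (c := u * (1 - w) / (w * (1 - u))) hp
    (N := fun q => q.1 * (1 - q.2.2)) (D := fun q => q.2.2 * (1 - q.1))
    (fun _ => rfl) (by fun_prop) (by fun_prop) (fun s => mul_ne_zero (u0 s) (w1 s)) (fun s => mul_ne_zero (w0 s) (u1 s))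
    (fun s => by convert wu s using 1; simp only [p]; ring)
    (r := a * (1 - c) / (c * (1 - a))) (by positivity) ((div_lt_one (by positivity)).2 (by nlinarith)) (by
      simp only [hp0]
      push_cast
      congr 1)
  have x6 := continuableAlong_polylogSeries_and_hasContinuedValue (c := v / (v - w)) hp
    (N := fun q => q.2.1) (D := fun q => q.2.1 - q.2.2)
    (fun _ => rfl) (by fun_prop) (by fun_prop) (fun s => v0 s) (fun s => vw s)
    (fun s => by convert neg_ne_zero.2 (w0 s) using 1; simp only [p]; ring)
    (r := y / (y + c)) (by positivity) ((div_lt_one (by positivity)).2 (by nlinarith)) (by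
      simp only [hp0]
      rw [← neg_div_neg_eq]
      push_cast
      congr 1 <;> ring)
  have x7 := continuableAlong_polylogSeries_and_hasContinuedValue (c := v / (v - u)) hp
    (N := fun q => q.2.1) (D := fun q => q.2.1 - q.1)
    (fun _ => rfl) (by fun_prop) (by fun_prop) (fun s => v0 s) (fun s => vu s)
    (fun s => by convert neg_ne_zero.2 (u0 s) using 1; simp only [p]; ring)
    (r := y / (y + a)) (by positivity) ((div_lt_one (by positivity)).2 (by nlinarith)) (by
      simp only [hp0]
      rw [← neg_div_neg_eq]
      push_cast
      congr 1 <;> ring)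
  have x8 := continuableAlong_polylogSeries_and_hasContinuedValue (c := u / w) hp
    (N := fun q => q.1) (D := fun q => q.2.2)
    (fun _ => rfl) (by fun_prop) (by fun_prop) (fun s => u0 s) (fun s => w0 s)
    (fun s => by convert wu s using 1)
    (r := a / c) (by positivity) ((div_lt_one (by positivity)).2 (by nlinarith)) (by
      simp only [hp0]
      push_cast
      rfl)
  have x9 := continuableAlong_polylogSeries_and_hasContinuedValue (c := (v - u) / (v - w)) hp
    (N := fun q => q.2.1 - q.1) (D := fun q => q.2.1 - q.2.2)
    (fun _ => rfl) (by fun_prop) (by fun_prop) (fun s => vu s) (fun s => vw s)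
    (fun s => by convert neg_ne_zero.2 (wu s) using 1; simp only [p]; ring)
    (r := (a + y) / (c + y)) (by positivity) ((div_lt_one (by positivity)).2 (by nlinarith)) (by
      simp only [hp0]
      rw [← neg_div_neg_eq]
      push_cast
      congr 1 <;> ring)
  -- The two principal logarithms and the integral are each a single function holomorphic near the
  -- whole path, so their continued values are their actual values.
  have hlogu : HasContinuedValue p (fun q => Complex.log (1 - q.1)) (Complex.log (1 - u 1)) :=
    .of_differentiableAt fun s => (hdom s).mono fun q hq =>
      DifferentiableAt.clog (by fun_prop) hq.1
  have hlogw : HasContinuedValue p (fun q => Complex.log (1 - q.2.2)) (Complex.log (1 - w 1)) :=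
    .of_differentiableAt fun s => (hdom s).mono fun q hq =>
      DifferentiableAt.clog (by fun_prop) hq.2.2.1
  have hF : HasContinuedValue p (fun q => hzF 1 q.1 q.2.1 q.2.2) (hzF 1 (u 1) (v 1) (w 1)) :=
    .of_differentiableAt fun s => (hdom s).mono fun q hq => differentiableAt_hzF hq
  refine ⟨?_, ?_, ?_, ?_⟩
  · simp only [List.forall_mem_cons, List.not_mem_nil, false_imp_iff, implies_true, and_true]
    exact ⟨l1.1, l2.1, l3.1, l4.1, l5.1, l6.1, l7.1, l8.1, l9.1, l10.1, l11.1⟩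
  · simp only [List.forall_mem_cons, List.not_mem_nil, false_imp_iff, implies_true, and_true]
    exact ⟨(x1 2).1, (x2 2).1, (x3 2).1, (x4 2).1, (x5 2).1⟩
  · simp only [List.forall_mem_cons, List.not_mem_nil, false_imp_iff, implies_true, and_true]
    exact ⟨(x2 3).1, (x6 3).1, (x1 3).1, (x7 3).1, (x5 3).1, (x4 3).1, (x8 3).1, (x9 3).1⟩
  have hG := (((((((((((((hlogu.mul l1.2).mul l2.2).sub (hlogw.mul (x1 2).2)).sub
    ((hlogu.mul l3.2).mul l4.2)).sub (hlogu.mul (x2 2).2)).sub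
    (l5.2.mul ((x3 2).2.sub (l6.2.mul l7.2)))).add
    (l8.2.mul ((((x4 2).2.add (x1 2).2).sub (x2 2).2).sub (x5 2).2))).add
    (((hasContinuedValue_const (a := 1 / 2)).mul l9.2).mul (l10.2.sq.sub l11.2.sq))).add
    (x2 3).2).sub (x6 3).2).add (x1 3).2).sub (x7 3).2).add (x5 3).2).sub (x4 3).2
  have hG' := (hG.sub (x8 3).2).add (x9 3).2
  -- Both sides are continued along the same path, so agreement near the start suffices.
  refine hF.eq hp hG' ?_
  have hdiff : ∀ᶠ q in 𝓝 (p 0), DifferentiableAt ℂ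
      (fun q => hzF 1 q.1 q.2.1 q.2.2 - hzFormula q) q :=
    (hF.sub hG').eventually_differentiableAt
  rw [hp0] at hdiff ⊢
  have t1 : Tendsto (fun x : ℝ × ℝ × ℝ => x.1) (𝓝 (a, -y, c)) (𝓝 a) := continuousAt_fst
  have t2 : Tendsto (fun x : ℝ × ℝ × ℝ => x.2.1) (𝓝 (a, -y, c)) (𝓝 (-y)) :=
    (continuous_fst.comp continuous_snd).continuousAt
  have t3 : Tendsto (fun x : ℝ × ℝ × ℝ => x.2.2) (𝓝 (a, -y, c)) (𝓝 c) :=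
    (continuous_snd.comp continuous_snd).continuousAt
  have := eventually_eq_zero_of_real hdiff (by
    filter_upwards [t2.eventually_lt_const hb, t1.eventually_const_lt ha, t1.eventually_lt t3 hac,
      t3.eventually_lt_const hc1] with x k1 k2 k3 k4
    exact sub_eq_zero.2 (hzF_eq_hzFormula_of_real k1 k2 k3 k4))
  filter_upwards [this] with q hq using sub_eq_zero.1 hq
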